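/- Let $\mathcal G=(\mathcal V,\mathcal E)$ be a connected undirected graph on $\mathcal V=\{1,\dots,N\}$, and write $\mathcal N_i$ for the set of neighbours of $i$. For $x\in\mathbb R$ let $\lceil x\rfloor^{1/2}=|x|^{1/2}\,\mathrm{sign}(x)$. There are gains $k_0,k_1>0$, depending only on $\mathcal G$, such that the following holds for all $\gamma\ge 0$ and $L>0$. Let $s_1,\dots,s_N:[0,\infty)\to\mathbb R$ be twice differentiable signals with average $\bar s=\frac1N\sum_{i=1}^N s_i$, and suppose that for every $i$ and all $t\ge 0$ $$\Big|\ddot{\bar s}(t)-\ddot s_i(t)+2\gamma\big(\dot{\bar s}(t)-\dot s_i(t)\big)+\gamma^2\big(\bar s(t)-s_i(t)\big)\Big|\le \frac{L}{\sqrt N}.$$ Consider the first-order REDCHO protocol $$\dot\eta_{i,0}=k_0\sqrt L\sum_{j\in\mathcal N_i}\lceil \hat s_{i,0}-\hat s_{j,0}\rfloor^{1/2}+\eta_{i,1}-\gamma\eta_{i,0},\qquad \dot\eta_{i,1}=k_1L\sum_{j\in\mathcal N_i}\mathrm{sign}(\hat s_{i,0}-\hat s_{j,0})-\gamma\eta_{i,1},$$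 with estimates $\hat s_{i,0}=s_i-\eta_{i,0}$ and $\hat s_{i,1}=\dot s_i-\eta_{i,1}+\gamma\eta_{i,0}$. Its trajectories are the locally absolutely continuous functions on $[0,\infty)$ that satisfy these equations for almost every $t$, read as a differential inclusion: on each edge $\{i,j\}$, $\mathrm{sign}(0)$ may be replaced by any value in $[-1,1]$, with opposite values for $(i,j)$ and $(j,i)$. Then for arbitrary initial values $\eta_{i,0}(0),\eta_{i,1}(0)\in\mathbb R$: (a) there is a finite $T\ge 0$ such that every trajectory with these initial values satisfies $\hat s_{i,0}(t)=\hat s_{j,0}(t)$ and $\hat s_{i,1}(t)=\hat s_{j,1}(t)$ for all $i,j\in\mathcal V$ and all $t\ge T$; (b) if $\gamma>0$, or if $\gamma=0$ and $\sum_{i}\eta_{i,0}(0)=\sum_{i}\eta_{i,1}(0)=0$, then every trajectory with these initial values satisfies, for each $i$, $\lim_{t\to\infty}|\hat s_{i,0}(t)-\bar s(t)|=0$ and $\lim_{t\to\infty}|\hat s_{i,1}(t)-\dot{\bar s}(t)|=0$. -/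

import Mathlib

open Set Filter Topology MeasureTheory

noncomputable section

namespace Redcho

/-- Time derivative of a signal defined on `[0, ∞)` (one-sided at `t = 0`). -/
def dot (f : ℝ → ℝ) (t : ℝ) : ℝ := derivWithin f (Ici 0) t

/-- `f` is twice differentiable on `[0, ∞)`. -/
def TwiceDifferentiable (f : ℝ → ℝ) : Prop :=
  DifferentiableOn ℝ f (Ici 0) ∧ DifferentiableOn ℝ (dot f) (Ici 0)

/-- The average signal `s̄(t) = (1/N) ∑ᵢ sᵢ(t)`. -/
def avg {N : ℕ} (s : Fin N → ℝ → ℝ) (t : ℝ) : ℝ := (1 / (N : ℝ)) * ∑ i, s i t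

/-- The bounded-mismatch assumption: for every agent `i` and all `t ≥ 0`,
`|(s̄'' - sᵢ'') + 2γ (s̄' - sᵢ') + γ² (s̄ - sᵢ)| ≤ L / √N`. -/
def BoundedMismatch {N : ℕ} (s : Fin N → ℝ → ℝ) (γ L : ℝ) : Prop :=
  ∀ i : Fin N, ∀ t : ℝ, 0 ≤ t →
    |(dot (dot (avg s)) t - dot (dot (s i)) t) + 2 * γ * (dot (avg s) t - dot (s i) t)
      + γ ^ 2 * (avg s t - s i t)| ≤ L / Real.sqrt N

/-- The signed power `⌈x⌋^α = |x|^α sign x` (used for `α > 0`). -/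
def signedPow (x α : ℝ) : ℝ := |x| ^ α * Real.sign x

/-- The set-valued sign: `{1}` for `x > 0`, `{-1}` for `x < 0`, and `[-1, 1]` for `x = 0`. -/
def signSet (x : ℝ) : Set ℝ := {σ | (0 < x → σ = 1) ∧ (x < 0 → σ = -1) ∧ σ ∈ Icc (-1 : ℝ) 1}

/-- Shared information `ŝ_{i,0} = sᵢ - η_{i,0}`. -/
def est0 {N : ℕ} (s η₀ : Fin N → ℝ → ℝ) (i : Fin N) (t : ℝ) : ℝ := s i t - η₀ i t

/-- Differentiator output `ŝ_{i,1} = sᵢ' - η_{i,1} + γ η_{i,0}`. -/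
def est1 {N : ℕ} (γ : ℝ) (s η₀ η₁ : Fin N → ℝ → ℝ) (i : Fin N) (t : ℝ) : ℝ :=
  dot (s i) t - η₁ i t + γ * η₀ i t

/-- `(η₀, η₁)` is a trajectory on `[0, ∞)` of the first-order REDCHO protocol with initial
condition `(a, b)`. The right-hand side is discontinuous, so it is understood as a differential
inclusion: the functions are locally absolutely continuous on `[0, ∞)` and for almost every
`t ≥ 0` the equations hold for some selection `σ` of the set-valued sign of the differences
`ŝ_{i,0} - ŝ_{j,0}` along the edges. There is one value per undirected edge, with the sign given
by the orientation (as in `D sign(Dᵀ ŝ₀)` for an incidence matrix `D`), so `σ` is antisymmetric.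
Every Filippov solution, and every absolutely continuous solution in the almost-everywhere sense
with `sign 0 = 0`, is such a trajectory. -/
structure IsTrajectory {N : ℕ} (G : SimpleGraph (Fin N)) [DecidableRel G.Adj]
    (k₀ k₁ γ L : ℝ) (s : Fin N → ℝ → ℝ) (a b : Fin N → ℝ) (η₀ η₁ : Fin N → ℝ → ℝ) : Prop where
  init₀ : ∀ i, η₀ i 0 = a i
  init₁ : ∀ i, η₁ i 0 = b i
  ac₀ : ∀ i, ∀ T : ℝ, 0 ≤ T → AbsolutelyContinuousOnInterval (η₀ i) 0 T
  ac₁ : ∀ i, ∀ T : ℝ, 0 ≤ T → AbsolutelyContinuousOnInterval (η₁ i) 0 T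
  dynamics : ∀ᵐ t ∂(volume.restrict (Ici (0 : ℝ))), ∃ σ : Fin N → Fin N → ℝ,
    (∀ i j, σ j i = -σ i j) ∧
    (∀ i j, G.Adj i j → σ i j ∈ signSet (est0 s η₀ i t - est0 s η₀ j t)) ∧
    ∀ i,
      HasDerivAt (η₀ i)
        (k₀ * Real.sqrt L *
            ∑ j ∈ G.neighborFinset i, signedPow (est0 s η₀ i t - est0 s η₀ j t) (1 / 2)
          + η₁ i t - γ * η₀ i t) t ∧
      HasDerivAt (η₁ i)
        (k₁ * L * ∑ j ∈ G.neighborFinset i, σ i j - γ * η₁ i t) t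

end Redcho

end

/-!
After subtraction of averages and with `ρ = k₀ √L`, the deviations `X` of the shared estimates and
the normalized deviations `ζ` of `sᵢ' + γ sᵢ - η_{i,1}` satisfy
`X' = -γ X + ρ (ζ - ∇Φ(X))`, `ζ' = -γ ζ + (ρ / k₀²) (-k₁ D sign(Dᵀ X) + d)`,
where `D` is the incidence matrix, `Φ(X) = (2/3) ∑ |Dᵀ X| ^ (3/2)` is convex and `d` is a bounded
disturbance with zero sum. For large `k₀` the variable `ζ` is slow and `X` follows the minimizer
`Y = ∇Φ*(ζ)` of `Φ - ⟪·, ζ⟫`. On this slow manifold the conjugate `Φ*` decreases, because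
`⟪Y, -k₁ D sign(Dᵀ Y) + d⟫ = -k₁ ‖Dᵀ Y‖₁ + ⟪Y, d⟫` is negative once `k₁` dominates the disturbance.

This suggests the Lyapunov function `V = Φ(X) - ⟪X, ζ⟫ + 3 Φ*(ζ)`. Along trajectories
`V' ≤ ρ (-|ζ - ∇Φ(X)|² + k₀⁻² ⟪3 Y - X, -k₁ D sign(Dᵀ X) + d⟫)`, the damping being harmless by
Fenchel's inequality (`lyapunov_deriv_le`). Strong monotonicity of `∇Φ`
(`edgeNorm_sub_le_coupling`) bounds `Y - X` by the mismatch `∇Φ(Y) - ∇Φ(X) = ζ - ∇Φ(X)`, so that the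
last term is at most `k₀⁻² (-‖Dᵀ X‖₁ + C |ζ - ∇Φ(X)|²)` (`sum_mul_forcing_signGain_le`), and
`k₀² ≥ C + 1` gives `V' ≤ -(ρ / k₀²) E` with `E = ‖Dᵀ X‖₁ + |ζ - ∇Φ(X)|²`. Since `V` is at most a
multiple of `E ^ (3/2)` (`lyapunov_le`), it vanishes after a finite time that depends on its initial
value only (`eq_zero_of_deriv_le`). No constant depends on `γ` or `L`.

The averages of the protocol states solve a linear system without coupling terms, with an explicit
solution (`IsTrajectory.avg_eq`); together with consensus this gives the convergence to the average
signal and its derivative.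
-/

/-! ### Absolutely continuous functions and finite-time extinction -/

namespace AbsolutelyContinuousOnInterval

/-- A function whose increments are controlled by those of finitely many absolutely continuous
functions is absolutely continuous. -/
theorem of_abs_sub_le_sum {ι : Type*} [Fintype ι] {f : ι → ℝ → ℝ} {g : ℝ → ℝ} {a b C : ℝ}
    (hf : ∀ i, AbsolutelyContinuousOnInterval (f i) a b)
    (hg : ∀ x ∈ uIcc a b, ∀ y ∈ uIcc a b, |g x - g y| ≤ C * ∑ i, |f i x - f i y|) :
    AbsolutelyContinuousOnInterval g a b := by
  have h0 : Tendsto (fun E : ℕ × (ℕ → ℝ × ℝ) ↦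
      C * ∑ i, ∑ n ∈ Finset.range E.1, dist (f i (E.2 n).1) (f i (E.2 n).2))
      (totalLengthFilter ⊓ 𝓟 (disjWithin a b)) (𝓝 0) := by
    simpa using (tendsto_finsetSum Finset.univ fun i _ => hf i).const_mul C
  refine tendsto_of_tendsto_of_tendsto_of_le_of_le' tendsto_const_nhds h0
    (Eventually.of_forall fun E => Finset.sum_nonneg fun _ _ => dist_nonneg) ?_
  refine eventually_inf_principal.2 (Eventually.of_forall fun E hE => ?_)
  rw [Finset.sum_comm, Finset.mul_sum]
  refine Finset.sum_le_sum fun n hn => ?_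
  simpa only [Real.dist_eq] using hg _ (hE.1 n hn).1 _ (hE.1 n hn).2

theorem finset_sum {ι : Type*} {f : ι → ℝ → ℝ} {a b : ℝ} (s : Finset ι)
    (hf : ∀ i ∈ s, AbsolutelyContinuousOnInterval (f i) a b) :
    AbsolutelyContinuousOnInterval (fun t => ∑ i ∈ s, f i t) a b := by
  refine of_abs_sub_le_sum (ι := s) (f := fun i => f i) (C := 1) (fun i => hf i i.2)
    fun x _ y _ => ?_
  rw [one_mul, ← Finset.sum_sub_distrib, Finset.sum_coe_sort s fun i => |f i x - f i y|]
  exact Finset.abs_sum_le_sum_abs _ _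

/-- A locally absolutely continuous function on `[0, ∞)` is differentiable almost everywhere. -/
theorem ae_restrict_Ici_differentiableAt {f : ℝ → ℝ}
    (hf : ∀ T, 0 ≤ T → AbsolutelyContinuousOnInterval f 0 T) :
    ∀ᵐ t ∂(volume.restrict (Ici (0 : ℝ))), DifferentiableAt ℝ f t := by
  rw [ae_restrict_iff' measurableSet_Ici]
  have h := ae_all_iff.2 fun n : ℕ => (hf n n.cast_nonneg).ae_differentiableAt
  filter_upwards [h] with t ht ht0
  obtain ⟨n, hn⟩ := exists_nat_ge t
  exact ht n (by rw [uIcc_of_le n.cast_nonneg]; exact ⟨ht0, hn⟩)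

/-- A one-sided mean value inequality for absolutely continuous functions. -/
theorem sub_le_of_ae_deriv_le {f : ℝ → ℝ} {a b c : ℝ} (hab : a ≤ b)
    (hf : AbsolutelyContinuousOnInterval f a b)
    (hf' : ∀ᵐ x, x ∈ Icc a b → ∃ v, HasDerivAt f v x ∧ v ≤ c) :
    f b - f a ≤ c * (b - a) := by
  rw [← hf.integral_deriv_eq_sub]
  have : ∫ _ in a..b, c = c * (b - a) := by simp [mul_comm]
  rw [← this]
  refine intervalIntegral.integral_mono_ae_restrict hab hf.intervalIntegrable_deriv
    intervalIntegrable_const ?_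
  rw [EventuallyLE, ae_restrict_iff' measurableSet_Icc]
  filter_upwards [hf'] with x hx hxm
  obtain ⟨v, hv, hvc⟩ := hx hxm
  rwa [hv.deriv]

end AbsolutelyContinuousOnInterval

namespace Redcho

theorem ae_Icc_of_ae_Ici {p : ℝ → Prop} (h : ∀ᵐ t ∂(volume.restrict (Ici (0 : ℝ))), p t)
    {a : ℝ} (ha : 0 ≤ a) (b : ℝ) : ∀ᵐ t, t ∈ Icc a b → p t := by
  rw [ae_restrict_iff' measurableSet_Ici] at h
  filter_upwards [h] with t ht hm using ht (ha.trans hm.1)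

/-- A nonnegative absolutely continuous function with `V' ≤ -κ e²` for some `e` such that
`V ≤ (K e)³`, so that `V' ≤ -(κ / K²) V ^ (2 / 3)`, vanishes after a time that depends on `V 0` only:
as long as `V` is positive, its cube root decreases at rate at least `κ / (3 K²)`. -/
theorem eq_zero_of_deriv_le {V : ℝ → ℝ} {K κ : ℝ} (hK : 0 < K) (hκ : 0 < κ)
    (hac : ∀ T, 0 ≤ T → AbsolutelyContinuousOnInterval V 0 T) (hV : ∀ t, 0 ≤ V t)
    (hV' : ∀ᵐ t ∂(volume.restrict (Ici (0 : ℝ))), ∃ v, HasDerivAt V v t ∧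
      ∃ e, 0 ≤ e ∧ V t ≤ (K * e) ^ 3 ∧ v ≤ -κ * e ^ 2)
    {t : ℝ} (ht : 3 * K ^ 2 / κ * V 0 ^ (1 / 3 : ℝ) < t) : V t = 0 := by
  have ht0 : 0 ≤ t := by
    refine le_trans ?_ ht.le
    have := Real.rpow_nonneg (hV 0) (1 / 3)
    positivity
  by_contra hne
  have hpos : 0 < V t := lt_of_le_of_ne (hV t) (Ne.symm hne)
  have hanti : ∀ s ∈ Icc 0 t, V t ≤ V s := by
    intro s hs
    have := (hac t ht0).mono (c := s) (d := t) (by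
      rw [uIcc_of_le hs.2, uIcc_of_le ht0]; exact Icc_subset_Icc_left hs.1)
    have := this.sub_le_of_ae_deriv_le (c := 0) hs.2 (by
      filter_upwards [ae_Icc_of_ae_Ici hV' hs.1 t] with x hx hm
      obtain ⟨v, hv, e, he, -, h⟩ := hx hm
      exact ⟨v, hv, h.trans (by nlinarith [sq_nonneg e])⟩)
    linarith
  set W : ℝ → ℝ := fun s => V s ^ (1 / 3 : ℝ) with hW
  have hW3 : ∀ s, W s ^ 3 = V s := fun s => by
    rw [hW]; dsimp only
    rw [← Real.rpow_natCast, ← Real.rpow_mul (hV s)]; norm_num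
  have hW0 : ∀ s, 0 ≤ W s := fun s => Real.rpow_nonneg (hV s) _
  have hWt : 0 < W t := Real.rpow_pos_of_pos hpos _
  have hWanti : ∀ s ∈ Icc 0 t, W t ≤ W s := fun s hs =>
    Real.rpow_le_rpow (hV t) (hanti s hs) (by norm_num)
  have hWac : AbsolutelyContinuousOnInterval W 0 t := by
    refine AbsolutelyContinuousOnInterval.of_abs_sub_le_sum (ι := Unit) (f := fun _ => V)
      (C := (W t ^ 2)⁻¹) (fun _ => hac t ht0) fun x hx y hy => ?_
    rw [uIcc_of_le ht0] at hx hy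
    have h1 := hWanti x hx
    have h2 := hWanti y hy
    rw [Fintype.sum_unique, ← hW3 x, ← hW3 y, inv_mul_eq_div, le_div_iff₀ (by positivity)]
    rw [show W x ^ 3 - W y ^ 3 = (W x - W y) * (W x ^ 2 + W x * W y + W y ^ 2) by ring, abs_mul]
    refine mul_le_mul_of_nonneg_left ?_ (abs_nonneg _)
    refine le_trans ?_ (le_abs_self _)
    nlinarith [hW0 x, hW0 y, mul_nonneg (hW0 x) (hW0 y), sq_nonneg (W y)]
  have key := hWac.sub_le_of_ae_deriv_le (c := -(κ / (3 * K ^ 2))) ht0 (by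
    filter_upwards [ae_Icc_of_ae_Ici hV' le_rfl t] with x hx hm
    obtain ⟨v, hv, e, he, hVe, hve⟩ := hx hm
    have hVx : 0 < V x := hpos.trans_le (hanti x hm)
    refine ⟨_, hv.rpow_const (Or.inl hVx.ne'), ?_⟩
    have hWx : 0 < W x := Real.rpow_pos_of_pos hVx _
    have h1 : V x ^ ((1 / 3 : ℝ) - 1) = (W x ^ 2)⁻¹ := by
      rw [hW]; dsimp only
      rw [← Real.rpow_natCast, ← Real.rpow_mul hVx.le, ← Real.rpow_neg hVx.le]; norm_num
    have h2 : W x ≤ K * e := by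
      refine le_of_pow_le_pow_left₀ (n := 3) (by norm_num) (by positivity) ?_
      rwa [hW3]
    rw [h1, ← div_eq_mul_inv, div_le_iff₀ (by positivity)]
    have h3 : W x ^ 2 ≤ (K * e) ^ 2 := pow_le_pow_left₀ hWx.le h2 2
    have h4 : κ / (3 * K ^ 2) * W x ^ 2 ≤ κ / (3 * K ^ 2) * (K * e) ^ 2 := by gcongr
    have h5 : κ / (3 * K ^ 2) * (K * e) ^ 2 = κ * e ^ 2 / 3 := by field_simp
    linarith)
  have h6 : κ / (3 * K ^ 2) * (3 * K ^ 2 / κ * V 0 ^ (1 / 3 : ℝ)) < κ / (3 * K ^ 2) * t := by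
    gcongr
  have h7 : κ / (3 * K ^ 2) * (3 * K ^ 2 / κ * V 0 ^ (1 / 3 : ℝ)) = W 0 := by
    rw [hW]; field_simp
  linarith [hWt]

/-! ### The signed square root -/

theorem signedPow_half (x : ℝ) : signedPow x (1 / 2) = √|x| * Real.sign x := by
  rw [signedPow, Real.sqrt_eq_rpow]

theorem signedPow_half_of_nonneg {x : ℝ} (hx : 0 ≤ x) : signedPow x (1 / 2) = √x := by
  rw [signedPow_half, abs_of_nonneg hx]
  rcases hx.eq_or_lt with rfl | h
  · simp
  · rw [Real.sign_of_pos h, mul_one]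

theorem signedPow_half_neg (x : ℝ) : signedPow (-x) (1 / 2) = -signedPow x (1 / 2) := by
  rw [signedPow_half, signedPow_half, abs_neg, Real.sign_neg, mul_neg]

theorem signedPow_half_mul_self (x : ℝ) : signedPow x (1 / 2) * x = |x| * √|x| := by
  rcases le_total 0 x with h | h
  · rw [signedPow_half_of_nonneg h, abs_of_nonneg h, mul_comm]
  · obtain ⟨y, rfl⟩ : ∃ y, x = -y := ⟨-x, by ring⟩
    rw [signedPow_half_neg, signedPow_half_of_nonneg (by linarith), abs_neg,
      abs_of_nonneg (by linarith)]
    ring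

/-- Quantitative monotonicity of the signed square root. -/
theorem sq_sub_le_signedPow_half {x y S : ℝ} (hS : √|x| + √|y| ≤ S) :
    (x - y) ^ 2 ≤ (signedPow x (1 / 2) - signedPow y (1 / 2)) * (x - y) * S := by
  have key : ∀ p q : ℝ, 0 ≤ p → √|p| + √|q| ≤ S →
      (p - q) ^ 2 ≤ (signedPow p (1 / 2) - signedPow q (1 / 2)) * (p - q) * S := by
    intro p q hp h
    obtain ⟨a, ha, rfl⟩ : ∃ a, 0 ≤ a ∧ p = a ^ 2 := ⟨√p, Real.sqrt_nonneg _, (Real.sq_sqrt hp).symm⟩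
    rw [signedPow_half_of_nonneg (sq_nonneg a), Real.sqrt_sq ha]
    rw [abs_of_nonneg (sq_nonneg a), Real.sqrt_sq ha] at h
    rcases le_total 0 q with hq | hq
    · obtain ⟨b, hb, rfl⟩ : ∃ b, 0 ≤ b ∧ q = b ^ 2 :=
        ⟨√q, Real.sqrt_nonneg _, (Real.sq_sqrt hq).symm⟩
      rw [signedPow_half_of_nonneg (sq_nonneg b), Real.sqrt_sq hb]
      rw [abs_of_nonneg (sq_nonneg b), Real.sqrt_sq hb] at h
      have : 0 ≤ (a - b) ^ 2 * (a + b) := by positivity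
      nlinarith [mul_le_mul_of_nonneg_left h this]
    · obtain ⟨b, hb, rfl⟩ : ∃ b, 0 ≤ b ∧ q = -b ^ 2 :=
        ⟨√(-q), Real.sqrt_nonneg _, by rw [Real.sq_sqrt (by linarith)]; ring⟩
      rw [signedPow_half_neg, signedPow_half_of_nonneg (sq_nonneg b), Real.sqrt_sq hb]
      rw [abs_neg, abs_of_nonneg (sq_nonneg b), Real.sqrt_sq hb] at h
      have h1 : 0 ≤ (a + b) * (a ^ 2 + b ^ 2) := by positivity
      have h2 := mul_le_mul_of_nonneg_left h h1
      have h3 : 0 ≤ a * b * (a ^ 2 + b ^ 2) := by positivity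
      nlinarith
  rcases le_total 0 x with h | h
  · exact key x y h hS
  · have := key (-x) (-y) (by linarith) (by simpa only [abs_neg] using hS)
    rw [signedPow_half_neg, signedPow_half_neg] at this
    linarith

theorem abs_abs_mul_sqrt_abs_sub_le (x y : ℝ) :
    |(|x| * √|x| - |y| * √|y|)| ≤ (√|x| + √|y|) * |x - y| := by
  refine le_trans ?_ (mul_le_mul_of_nonneg_left (abs_abs_sub_abs_le_abs_sub x y) (by positivity))
  obtain ⟨p, hp, hx⟩ : ∃ p, 0 ≤ p ∧ |x| = p ^ 2 :=
    ⟨√|x|, Real.sqrt_nonneg _, (Real.sq_sqrt (abs_nonneg x)).symm⟩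
  obtain ⟨q, hq, hy⟩ : ∃ q, 0 ≤ q ∧ |y| = q ^ 2 :=
    ⟨√|y|, Real.sqrt_nonneg _, (Real.sq_sqrt (abs_nonneg y)).symm⟩
  rw [hx, hy, Real.sqrt_sq hp, Real.sqrt_sq hq,
    show p ^ 2 * p - q ^ 2 * q = (p - q) * (p ^ 2 + p * q + q ^ 2) by ring,
    show p ^ 2 - q ^ 2 = (p - q) * (p + q) by ring, abs_mul, abs_mul,
    abs_of_nonneg (by positivity : 0 ≤ p ^ 2 + p * q + q ^ 2), abs_of_nonneg (add_nonneg hp hq)]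
  nlinarith [abs_nonneg (p - q), mul_nonneg (abs_nonneg (p - q)) (mul_nonneg hp hq)]

theorem hasDerivAt_abs_mul_sqrt_abs (x : ℝ) :
    HasDerivAt (fun y : ℝ => |y| * √|y|) (3 / 2 * signedPow x (1 / 2)) x := by
  have hpos : ∀ z : ℝ, 0 < z → HasDerivAt (fun y : ℝ => |y| * √|y|) (3 / 2 * √z) z := by
    intro z hz
    have h := (hasDerivAt_id z).mul (Real.hasDerivAt_sqrt hz.ne')
    refine (h.congr_of_eventuallyEq ?_).congr_deriv ?_
    · filter_upwards [eventually_gt_nhds hz] with y hy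
      simp [abs_of_pos hy]
    · have : z = √z * √z := (Real.mul_self_sqrt hz.le).symm
      have h0 : √z ≠ 0 := (Real.sqrt_pos.2 hz).ne'
      simp only [id]
      field_simp
      nlinarith
  rcases lt_trichotomy x 0 with h | rfl | h
  · have h1 := (hpos (-x) (by linarith)).comp x (hasDerivAt_neg x)
    refine (h1.congr_of_eventuallyEq ?_).congr_deriv ?_
    · filter_upwards with y
      simp
    · rw [← neg_neg x, signedPow_half_neg, neg_neg, signedPow_half_of_nonneg (by linarith)]
      ring
  · rw [hasDerivAt_iff_isLittleO_nhds_zero]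
    have : (fun h : ℝ => |0 + h| * √|0 + h| - |(0:ℝ)| * √|(0:ℝ)| -
        h • (3 / 2 * signedPow 0 (1 / 2))) = fun h => |h| * √|h| := by
      ext h; simp [signedPow]
    rw [this]
    have hs : Tendsto (fun h : ℝ => √|h|) (𝓝 0) (𝓝 0) := by
      have : Continuous (fun h : ℝ => √|h|) := by fun_prop
      simpa using this.tendsto 0
    have := (Asymptotics.isBigO_refl (fun h : ℝ => |h|) (𝓝 0)).mul_isLittleO
      ((Asymptotics.isLittleO_one_iff ℝ).2 hs)
    simp only [mul_one] at this
    exact this.trans_isBigO (Asymptotics.isBigO_abs_left.2 (Asymptotics.isBigO_refl _ _))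
  · rw [signedPow_half_of_nonneg h.le]
    exact hpos x h

end Redcho

namespace Redcho

theorem signedPow_half_antisymm {V : Type*} (X : V → ℝ) (i j : V) :
    signedPow (X j - X i) (1 / 2) = -signedPow (X i - X j) (1 / 2) := by
  rw [← signedPow_half_neg, neg_sub]

variable {V : Type*} [Fintype V] (G : SimpleGraph V) [DecidableRel G.Adj]

/-! ### Sums over the edges of a graph -/

/-- Sum over ordered pairs of adjacent vertices, so that each edge counts twice. -/
def edgeSum (f : V → V → ℝ) : ℝ := ∑ i, ∑ j ∈ G.neighborFinset i, f i j

/-- The `ℓ¹` seminorm of the edge differences of `X`, each edge counted twice. On a connected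
graph it vanishes only at constant vectors. -/
def edgeNorm (X : V → ℝ) : ℝ := edgeSum G fun i j => |X i - X j|

/-- The convex potential `Φ(X) = (2/3) ∑_{edges} |X i - X j| ^ (3/2)`. -/
noncomputable def potential (X : V → ℝ) : ℝ := 1 / 3 * edgeSum G fun i j => |X i - X j| * √|X i - X j|

/-- The gradient of `potential`: the coupling term of the protocol. -/
noncomputable def coupling (X : V → ℝ) (i : V) : ℝ :=
  ∑ j ∈ G.neighborFinset i, signedPow (X i - X j) (1 / 2)

/-- The convex conjugate of `potential`. The supremum is finite only if `∑ i, ζ i = 0`, since the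
potential is invariant under adding constants. -/
noncomputable def conjugate (ζ : V → ℝ) : ℝ := ⨆ X : V → ℝ, (∑ i, X i * ζ i - potential G X)

variable {G}

theorem edgeSum_le_edgeSum {f g : V → V → ℝ} (h : ∀ i j, G.Adj i j → f i j ≤ g i j) :
    edgeSum G f ≤ edgeSum G g :=
  Finset.sum_le_sum fun i _ => Finset.sum_le_sum fun j hj => h i j (by simpa using hj)

theorem edgeSum_congr {f g : V → V → ℝ} (h : ∀ i j, G.Adj i j → f i j = g i j) :
    edgeSum G f = edgeSum G g :=
  Finset.sum_congr rfl fun i _ => Finset.sum_congr rfl fun j hj => h i j (by simpa using hj)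

theorem edgeSum_nonneg {f : V → V → ℝ} (h : ∀ i j, 0 ≤ f i j) : 0 ≤ edgeSum G f :=
  Finset.sum_nonneg fun i _ => Finset.sum_nonneg fun j _ => h i j

theorem le_edgeSum {f : V → V → ℝ} (h : ∀ i j, 0 ≤ f i j) {i j : V} (hij : G.Adj i j) :
    f i j ≤ edgeSum G f :=
  (Finset.single_le_sum (f := fun j => f i j) (fun j _ => h i j)
    (by simpa using hij : j ∈ G.neighborFinset i)).trans
    (Finset.single_le_sum (f := fun i => ∑ j ∈ G.neighborFinset i, f i j)
      (fun i _ => Finset.sum_nonneg fun j _ => h i j) (Finset.mem_univ i))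

theorem edgeSum_mul_left (c : ℝ) (f : V → V → ℝ) :
    edgeSum G (fun i j => c * f i j) = c * edgeSum G f := by
  simp only [edgeSum, Finset.mul_sum]

theorem edgeSum_add (f g : V → V → ℝ) :
    edgeSum G (fun i j => f i j + g i j) = edgeSum G f + edgeSum G g := by
  simp only [edgeSum, Finset.sum_add_distrib]

theorem edgeSum_swap (f : V → V → ℝ) : edgeSum G (fun i j => f j i) = edgeSum G f := by
  unfold edgeSum
  rw [Finset.sum_comm']
  simp [SimpleGraph.adj_comm]

theorem edgeSum_const_le {c : ℝ} (hc : 0 ≤ c) :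
    edgeSum G (fun _ _ => c) ≤ (Fintype.card V : ℝ) ^ 2 * c := by
  have h : ∀ i, ∑ _j ∈ G.neighborFinset i, c ≤ (Fintype.card V : ℝ) * c := fun i => by
    rw [Finset.sum_const, nsmul_eq_mul]
    gcongr
    exact_mod_cast Finset.card_le_univ _
  calc edgeSum G (fun _ _ => c) ≤ ∑ _i : V, (Fintype.card V : ℝ) * c :=
        Finset.sum_le_sum fun i _ => h i
    _ = _ := by rw [Finset.sum_const, nsmul_eq_mul, Finset.card_univ]; ring

theorem sq_edgeSum_le (f : V → V → ℝ) :
    edgeSum G f ^ 2 ≤ (Fintype.card V : ℝ) ^ 2 * edgeSum G fun i j => f i j ^ 2 := by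
  have h : ∀ i, (∑ j ∈ G.neighborFinset i, f i j) ^ 2 ≤
      (Fintype.card V : ℝ) * ∑ j ∈ G.neighborFinset i, f i j ^ 2 := fun i => by
    refine (sq_sum_le_card_mul_sum_sq).trans ?_
    gcongr
    · exact Finset.card_le_univ _
  calc edgeSum G f ^ 2 ≤ (Fintype.card V : ℝ) * ∑ i, (∑ j ∈ G.neighborFinset i, f i j) ^ 2 :=
        sq_sum_le_card_mul_sum_sq
    _ ≤ (Fintype.card V : ℝ) * ∑ i, (Fintype.card V : ℝ) * ∑ j ∈ G.neighborFinset i, f i j ^ 2 := by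
        gcongr with i _
        exact h i
    _ = _ := by rw [edgeSum, ← Finset.mul_sum]; ring

/-- Summation by parts: for antisymmetric `σ`, `⟪X, D σ⟫ = ⟪Dᵀ X, σ⟫`. -/
theorem sum_mul_sum_neighbor (X : V → ℝ) {σ : V → V → ℝ} (hσ : ∀ i j, σ j i = -σ i j) :
    ∑ i, X i * ∑ j ∈ G.neighborFinset i, σ i j =
      1 / 2 * edgeSum G fun i j => (X i - X j) * σ i j := by
  have h1 : ∑ i, X i * ∑ j ∈ G.neighborFinset i, σ i j = edgeSum G fun i j => X i * σ i j := by
    simp only [edgeSum, Finset.mul_sum]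
  have h2 := edgeSum_swap (G := G) fun i j => X i * σ i j
  have h3 : edgeSum G (fun i j => (X i - X j) * σ i j) =
      edgeSum G (fun i j => X i * σ i j) + edgeSum G (fun i j => X j * σ j i) := by
    rw [← edgeSum_add]
    refine edgeSum_congr fun i j _ => ?_
    rw [hσ i j]; ring
  rw [h1, h3, h2]; ring

theorem sum_sum_neighbor_eq_zero {σ : V → V → ℝ} (hσ : ∀ i j, σ j i = -σ i j) :
    ∑ i, ∑ j ∈ G.neighborFinset i, σ i j = 0 := by
  have := sum_mul_sum_neighbor (G := G) (fun _ => 1) hσ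
  simpa [edgeSum] using this

theorem sum_coupling (X : V → ℝ) : ∑ i, coupling G X i = 0 :=
  sum_sum_neighbor_eq_zero (signedPow_half_antisymm X)

theorem sum_mul_coupling (X : V → ℝ) : ∑ i, X i * coupling G X i = 3 / 2 * potential G X := by
  unfold coupling potential
  rw [sum_mul_sum_neighbor X (signedPow_half_antisymm X)]
  simp_rw [mul_comm (X _ - X _), signedPow_half_mul_self]
  ring

theorem edgeNorm_nonneg (X : V → ℝ) : 0 ≤ edgeNorm G X := edgeSum_nonneg fun _ _ => abs_nonneg _

theorem potential_nonneg (X : V → ℝ) : 0 ≤ potential G X :=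
  mul_nonneg (by norm_num) (edgeSum_nonneg fun _ _ => by positivity)

theorem abs_sub_le_edgeNorm_of_adj (X : V → ℝ) {i j : V} (h : G.Adj i j) :
    |X i - X j| ≤ edgeNorm G X :=
  le_edgeSum (f := fun i j => |X i - X j|) (fun _ _ => abs_nonneg _) h

theorem edgeNorm_sub_le (X Y : V → ℝ) :
    edgeNorm G Y ≤ edgeNorm G X + edgeNorm G (Y - X) := by
  unfold edgeNorm
  rw [← edgeSum_add]
  refine edgeSum_le_edgeSum fun i j _ => ?_
  rw [show Y i - Y j = (X i - X j) + ((Y - X) i - (Y - X) j) by simp only [Pi.sub_apply]; ring]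
  exact abs_add_le _ _

theorem abs_sub_le_length_mul (X : V → ℝ) {i j : V} (p : G.Walk i j) :
    |X i - X j| ≤ p.length * edgeNorm G X := by
  induction p with
  | nil => simp
  | @cons u v w h p ih =>
    rw [SimpleGraph.Walk.length_cons]
    push_cast
    have h1 := abs_sub_le_edgeNorm_of_adj X h
    have h2 := abs_sub_le (X u) (X v) (X w)
    linarith

theorem abs_sub_le_edgeNorm (hG : G.Connected) (X : V → ℝ) (i j : V) :
    |X i - X j| ≤ Fintype.card V * edgeNorm G X := by
  classical
  obtain ⟨p, hp⟩ := (hG i j).exists_isPath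
  refine (abs_sub_le_length_mul X p).trans ?_
  have := edgeNorm_nonneg (G := G) X
  gcongr
  exact hp.length_lt.le

/-- Duality between the edge seminorm and the `ℓ¹` norm on vectors with zero sum. -/
theorem abs_sum_mul_le (hG : G.Connected) (X : V → ℝ) {ζ : V → ℝ} (hζ : ∑ i, ζ i = 0) :
    |∑ i, X i * ζ i| ≤ Fintype.card V * edgeNorm G X * ∑ i, |ζ i| := by
  obtain ⟨o⟩ := hG.nonempty
  have h : ∑ i, X i * ζ i = ∑ i, (X i - X o) * ζ i := by
    simp only [sub_mul, Finset.sum_sub_distrib, ← Finset.mul_sum, hζ, mul_zero, sub_zero]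
  rw [h, Finset.mul_sum]
  refine (Finset.abs_sum_le_sum_abs _ _).trans (Finset.sum_le_sum fun i _ => ?_)
  rw [abs_mul]
  gcongr
  exact abs_sub_le_edgeNorm hG X i o

theorem edgeSum_abs_mul_sqrt_le (X : V → ℝ) :
    edgeSum G (fun i j => |X i - X j| * √|X i - X j|) ≤ edgeNorm G X * √(edgeNorm G X) := by
  unfold edgeNorm
  rw [mul_comm, ← edgeSum_mul_left]
  refine edgeSum_le_edgeSum fun i j h => ?_
  rw [mul_comm]
  gcongr
  exact abs_sub_le_edgeNorm_of_adj X h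

theorem potential_le (X : V → ℝ) :
    potential G X ≤ 1 / 3 * (edgeNorm G X * √(edgeNorm G X)) := by
  unfold potential
  gcongr
  exact edgeSum_abs_mul_sqrt_le X

/-- Coercivity of the potential, with a free parameter `μ` from Young's inequality. -/
theorem edgeNorm_le_potential (X : V → ℝ) {μ : ℝ} (hμ : 0 < μ) :
    edgeNorm G X ≤ 3 * potential G X / μ + (Fintype.card V : ℝ) ^ 2 * μ ^ 2 := by
  have h : ∀ u : ℝ, |u| ≤ μ⁻¹ * (|u| * √|u|) + μ ^ 2 := by
    intro u
    rw [inv_mul_eq_div]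
    rcases le_total (√|u|) μ with h | h
    · have h1 : |u| ≤ μ ^ 2 := by
        rw [← Real.sq_sqrt (abs_nonneg u)]
        exact pow_le_pow_left₀ (Real.sqrt_nonneg _) h 2
      have : 0 ≤ |u| * √|u| / μ := by positivity
      linarith
    · have : |u| ≤ |u| * √|u| / μ := by
        rw [le_div_iff₀ hμ]
        gcongr
      nlinarith [sq_nonneg μ]
  calc edgeNorm G X ≤ edgeSum G fun i j => μ⁻¹ * (|X i - X j| * √|X i - X j|) + μ ^ 2 :=
        edgeSum_le_edgeSum fun i j _ => h _
    _ = 3 * potential G X / μ + edgeSum G fun _ _ => μ ^ 2 := by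
        rw [edgeSum_add, edgeSum_mul_left, potential]; ring
    _ ≤ _ := by
        gcongr
        exact edgeSum_const_le (by positivity)

theorem hasDerivAt_potential {X : V → ℝ → ℝ} {X' : V → ℝ} {t : ℝ}
    (h : ∀ i, HasDerivAt (X i) (X' i) t) :
    HasDerivAt (fun s => potential G fun i => X i s)
      (∑ i, X' i * coupling G (fun i => X i t) i) t := by
  have h1 : HasDerivAt (fun s => potential G fun i => X i s)
      (1 / 3 * ∑ i, ∑ j ∈ G.neighborFinset i,
        3 / 2 * signedPow (X i t - X j t) (1 / 2) * (X' i - X' j)) t := by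
    unfold potential edgeSum
    refine HasDerivAt.const_mul _ (HasDerivAt.fun_sum fun i _ => HasDerivAt.fun_sum fun j _ => ?_)
    exact (hasDerivAt_abs_mul_sqrt_abs (X i t - X j t)).comp t ((h i).sub (h j))
  refine h1.congr_deriv ?_
  unfold coupling
  rw [sum_mul_sum_neighbor X' (signedPow_half_antisymm fun i => X i t), ← edgeSum,
    ← edgeSum_mul_left, ← edgeSum_mul_left]
  exact edgeSum_congr fun i j _ => by ring

theorem continuous_potential : Continuous (potential G) := by
  unfold potential edgeSum
  fun_prop

theorem potential_sub_const (X : V → ℝ) (c : ℝ) : potential G (fun i => X i - c) = potential G X := by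
  simp [potential]

/-! ### The convex conjugate of the potential -/

/-- On vectors with zero sum the supremum that defines the conjugate is attained, since the
potential is coercive modulo constants. -/
theorem exists_forall_le (hG : G.Connected) {ζ : V → ℝ} (hζ : ∑ i, ζ i = 0) :
    ∃ Y : V → ℝ, ∀ X : V → ℝ,
      ∑ i, X i * ζ i - potential G X ≤ ∑ i, Y i * ζ i - potential G Y := by
  obtain ⟨o⟩ := hG.nonempty
  set n : ℝ := (Fintype.card V : ℝ) with hn
  have hn0 : 0 ≤ n := Nat.cast_nonneg _
  set z := ∑ i, |ζ i| with hz
  have hz0 : 0 ≤ z := Finset.sum_nonneg fun _ _ => abs_nonneg _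
  set μ := 6 * n * z + 1 with hμ
  have hμ0 : 0 < μ := by positivity
  set C := n * z * (n ^ 2 * μ ^ 2) with hC
  -- Where the objective is nonnegative, the edge seminorm is bounded by `B`.
  set B := 6 * C / μ + n ^ 2 * μ ^ 2 with hB
  have hbound : ∀ X : V → ℝ, 0 ≤ ∑ i, X i * ζ i - potential G X → edgeNorm G X ≤ B := by
    intro X hX
    have h1 := (le_abs_self _).trans (abs_sum_mul_le hG X hζ)
    have h2 := edgeNorm_le_potential (G := G) X hμ0
    have hP := potential_nonneg (G := G) X
    have h3 : n * z * (3 * potential G X / μ) ≤ potential G X / 2 := by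
      rw [mul_div_assoc', div_le_iff₀ hμ0, hμ]
      nlinarith
    have h4 : n * edgeNorm G X * z ≤ potential G X / 2 + C := by
      have := mul_le_mul_of_nonneg_left h2 (mul_nonneg hn0 hz0)
      rw [mul_add] at this
      linarith
    have h5 : 3 * potential G X ≤ 6 * C := by linarith
    calc edgeNorm G X ≤ _ := h2
      _ ≤ 6 * C / μ + n ^ 2 * μ ^ 2 := by gcongr
  have hB0 : 0 ≤ B := by positivity
  obtain ⟨Y, -, hY⟩ := (isCompact_closedBall (0 : V → ℝ) (n * B)).exists_isMaxOn
    ⟨0, Metric.mem_closedBall_self (by positivity)⟩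
    (f := fun X : V → ℝ => ∑ i, X i * ζ i - potential G X)
    ((by fun_prop : Continuous fun X : V → ℝ => ∑ i, X i * ζ i).sub
      continuous_potential).continuousOn
  have hY0 : 0 ≤ ∑ i, Y i * ζ i - potential G Y := by
    have := hY (Metric.mem_closedBall_self (by positivity) : (0 : V → ℝ) ∈ _)
    simpa [potential, edgeSum] using this
  refine ⟨Y, fun X => ?_⟩
  have hX : ∑ i, X i * ζ i - potential G X =
      ∑ i, (X i - X o) * ζ i - potential G (fun i => X i - X o) := by
    rw [potential_sub_const]
    simp only [sub_mul, Finset.sum_sub_distrib, ← Finset.mul_sum, hζ, mul_zero, sub_zero]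
  rcases le_total (∑ i, X i * ζ i - potential G X) 0 with h | h
  · exact h.trans hY0
  · rw [hX]
    refine hY (?_ : (fun i => X i - X o) ∈ Metric.closedBall (0 : V → ℝ) (n * B))
    rw [mem_closedBall_zero_iff, pi_norm_le_iff_of_nonneg (by positivity)]
    intro i
    rw [Real.norm_eq_abs]
    refine (abs_sub_le_edgeNorm hG X i o).trans ?_
    gcongr
    exact hbound X h

/-- The maximizer `Y` in the definition of the conjugate solves `coupling Y = ζ`; the conjugate is
then `Φ(Y) / 2` because `Φ` is homogeneous of degree `3 / 2`. -/
theorem exists_coupling_eq (hG : G.Connected) {ζ : V → ℝ} (hζ : ∑ i, ζ i = 0) :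
    ∃ Y : V → ℝ, coupling G Y = ζ ∧ conjugate G ζ = 1 / 2 * potential G Y ∧
      ∀ X : V → ℝ, ∑ i, X i * ζ i - potential G X ≤ conjugate G ζ := by
  obtain ⟨Y, hY⟩ := exists_forall_le hG hζ
  have hYc : coupling G Y = ζ := by
    set E : V → ℝ := fun i => ζ i - coupling G Y i with hE
    have hX : ∀ i, HasDerivAt (fun s : ℝ => Y i + s * E i) (E i) 0 := fun i => by
      simpa using ((hasDerivAt_id (0 : ℝ)).mul_const (E i)).const_add (Y i)
    have h1 : HasDerivAt (fun s : ℝ => ∑ i, (Y i + s * E i) * ζ i -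
        potential G fun i => Y i + s * E i)
        (∑ i, E i * ζ i - ∑ i, E i * coupling G (fun i => Y i + 0 * E i) i) 0 :=
      (HasDerivAt.fun_sum fun i _ => (hX i).mul_const (ζ i)).sub (hasDerivAt_potential hX)
    have h2 : IsLocalMax (fun s : ℝ => ∑ i, (Y i + s * E i) * ζ i -
        potential G fun i => Y i + s * E i) 0 :=
      Eventually.of_forall fun s => by simpa using hY fun i => Y i + s * E i
    have h3 := h2.hasDerivAt_eq_zero h1
    simp only [zero_mul, add_zero] at h3
    have h4 : ∑ i, E i * E i = 0 := by
      rw [← h3, ← Finset.sum_sub_distrib]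
      exact Finset.sum_congr rfl fun i _ => by simp only [hE]; ring
    ext i
    have := (Finset.sum_eq_zero_iff_of_nonneg fun i _ => mul_self_nonneg (E i)).1 h4 i
      (Finset.mem_univ i)
    have : E i = 0 := mul_self_eq_zero.1 this
    simp only [hE] at this
    linarith
  have hconj : conjugate G ζ = ∑ i, Y i * ζ i - potential G Y :=
    le_antisymm (ciSup_le hY) (le_ciSup (f := fun X : V → ℝ => ∑ i, X i * ζ i - potential G X)
      ⟨_, forall_mem_range.2 hY⟩ Y)
  refine ⟨Y, hYc, ?_, fun X => hconj ▸ hY X⟩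
  rw [hconj, ← hYc, sum_mul_coupling]
  ring

/-- Strong monotonicity of the coupling. -/
theorem edgeNorm_sub_le_coupling (hG : G.Connected) (X Y : V → ℝ) :
    edgeNorm G (Y - X) ≤ 2 * (Fintype.card V : ℝ) ^ 3 *
      (√(edgeNorm G X) + √(edgeNorm G Y)) * ∑ i, |coupling G Y i - coupling G X i| := by
  set n : ℝ := (Fintype.card V : ℝ) with hn
  set S := √(edgeNorm G X) + √(edgeNorm G Y) with hS
  set R := ∑ i, |coupling G Y i - coupling G X i| with hR
  have hR0 : 0 ≤ R := Finset.sum_nonneg fun _ _ => abs_nonneg _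
  have hS0 : 0 ≤ S := by positivity
  have h1 := sq_edgeSum_le (G := G) fun i j => |(Y - X) i - (Y - X) j|
  have h2 : ∑ i, (Y - X) i * (coupling G Y i - coupling G X i) = 1 / 2 * edgeSum G fun i j =>
      ((Y - X) i - (Y - X) j) *
        (signedPow (Y i - Y j) (1 / 2) - signedPow (X i - X j) (1 / 2)) := by
    rw [← sum_mul_sum_neighbor]
    · simp only [coupling, Finset.sum_sub_distrib]
    · intro i j
      rw [signedPow_half_antisymm Y, signedPow_half_antisymm X]; ring
  have h3 : edgeSum G (fun i j => |(Y - X) i - (Y - X) j| ^ 2) ≤ edgeSum G fun i j => S *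
      (((Y - X) i - (Y - X) j) *
        (signedPow (Y i - Y j) (1 / 2) - signedPow (X i - X j) (1 / 2))) := by
    refine edgeSum_le_edgeSum fun i j hij => ?_
    have h : √|Y i - Y j| + √|X i - X j| ≤ S := by
      rw [hS, add_comm]
      gcongr
      · exact abs_sub_le_edgeNorm_of_adj X hij
      · exact abs_sub_le_edgeNorm_of_adj Y hij
    have := sq_sub_le_signedPow_half h
    rw [sq_abs]
    simp only [Pi.sub_apply]
    rw [show Y i - X i - (Y j - X j) = Y i - Y j - (X i - X j) by ring]
    linarith
  rw [edgeSum_mul_left] at h3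
  have h4 : ∑ i, (coupling G Y i - coupling G X i) = 0 := by
    rw [Finset.sum_sub_distrib, sum_coupling, sum_coupling, sub_zero]
  have h5 := (le_abs_self _).trans (abs_sum_mul_le hG (Y - X) h4)
  change edgeNorm G (Y - X) ^ 2 ≤ _ at h1
  rw [← hn, ← hR, h2] at h5
  rw [← hn] at h1
  set N := edgeNorm G (Y - X) with hN
  have hN0 : 0 ≤ N := edgeNorm_nonneg _
  have h6 : N ^ 2 ≤ N * (2 * n ^ 3 * S * R) := by
    refine h1.trans ?_
    have hn2 : 0 ≤ n ^ 2 := sq_nonneg n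
    refine (mul_le_mul_of_nonneg_left h3 hn2).trans ?_
    have := mul_le_mul_of_nonneg_left h5 (mul_nonneg hn2 hS0)
    linarith
  rcases hN0.eq_or_lt with h | h
  · rw [← h]; positivity
  · exact le_of_mul_le_mul_left (by nlinarith) h

end Redcho

namespace Redcho

variable {V : Type*} [Fintype V] {G : SimpleGraph V} [DecidableRel G.Adj]

theorem conjugate_nonneg (hG : G.Connected) {ζ : V → ℝ} (hζ : ∑ i, ζ i = 0) :
    0 ≤ conjugate G ζ := by
  obtain ⟨Y, -, h, -⟩ := exists_coupling_eq hG hζ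
  rw [h]
  exact mul_nonneg (by norm_num) (potential_nonneg Y)

theorem eq_of_potential_eq_zero (hG : G.Connected) {X : V → ℝ} (h : potential G X = 0) (i j : V) :
    X i = X j := by
  have h0 : edgeSum G (fun i j => |X i - X j| * √|X i - X j|) = 0 := by
    unfold potential at h; linarith
  have h1 : edgeNorm G X ≤ 0 := by
    have : edgeNorm G X ≤ edgeSum G fun _ _ => (0 : ℝ) := by
      refine edgeSum_le_edgeSum fun i j hij => ?_
      have := le_edgeSum (f := fun i j => |X i - X j| * √|X i - X j|) (fun _ _ => by positivity) hij
      rw [h0] at this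
      by_contra! hpos
      have := mul_pos hpos (Real.sqrt_pos.2 hpos)
      linarith
    simpa [edgeSum] using this
  have h2 := abs_sub_le_edgeNorm hG X i j
  have h3 : (Fintype.card V : ℝ) * edgeNorm G X ≤ 0 :=
    mul_nonpos_of_nonneg_of_nonpos (Nat.cast_nonneg _) h1
  exact sub_eq_zero.1 (abs_nonpos_iff.1 (h2.trans h3))

theorem eq_zero_of_conjugate_eq_zero (hG : G.Connected) {ζ : V → ℝ} (hζ : ∑ i, ζ i = 0)
    (h : conjugate G ζ = 0) : ζ = 0 := by
  obtain ⟨Y, hY, h', -⟩ := exists_coupling_eq hG hζ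
  have hP : potential G Y = 0 := by linarith
  ext i
  rw [← hY]
  refine Finset.sum_eq_zero fun j _ => ?_
  rw [eq_of_potential_eq_zero hG hP i j, sub_self, signedPow_half]
  simp

theorem conjugate_sub_le (hG : G.Connected) {ζ ζ' : V → ℝ} (hζ : ∑ i, ζ i = 0)
    (hζ' : ∑ i, ζ' i = 0) :
    conjugate G ζ - conjugate G ζ' ≤ Fintype.card V *
      (2 * (Fintype.card V : ℝ) ^ 3 * ∑ i, |ζ i|) ^ 2 * ∑ i, |ζ i - ζ' i| := by
  obtain ⟨Y, hY, hc, -⟩ := exists_coupling_eq hG hζ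
  obtain ⟨-, -, -, hle⟩ := exists_coupling_eq hG hζ'
  have h1 := hle Y
  have h2 : ∑ i, Y i * ζ i = 3 / 2 * potential G Y := by rw [← hY, sum_mul_coupling]
  have h3 : ∑ i, Y i * (ζ i - ζ' i) = ∑ i, Y i * ζ i - ∑ i, Y i * ζ' i := by
    simp only [mul_sub, Finset.sum_sub_distrib]
  have h4 := (le_abs_self _).trans (abs_sum_mul_le hG Y
    (ζ := fun i => ζ i - ζ' i) (by rw [Finset.sum_sub_distrib, hζ, hζ', sub_zero]))
  have h5 : edgeNorm G Y ≤ (2 * (Fintype.card V : ℝ) ^ 3 * ∑ i, |ζ i|) ^ 2 := by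
    have h := edgeNorm_sub_le_coupling hG 0 Y
    have e0 : edgeNorm G (0 : V → ℝ) = 0 := by simp [edgeNorm, edgeSum]
    have c0 : ∀ i, coupling G (0 : V → ℝ) i = 0 := fun i => by simp [coupling, signedPow]
    simp only [sub_zero, e0, c0, Real.sqrt_zero, zero_add, hY] at h
    have hN := edgeNorm_nonneg (G := G) Y
    set z := ∑ i, |ζ i|
    have hz : 0 ≤ z := Finset.sum_nonneg fun _ _ => abs_nonneg _
    have hs : √(edgeNorm G Y) ≤ 2 * (Fintype.card V : ℝ) ^ 3 * z := by
      rcases (Real.sqrt_nonneg (edgeNorm G Y)).eq_or_lt with h0 | h0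
      · rw [← h0]; positivity
      · refine le_of_mul_le_mul_left ?_ h0
        rw [Real.mul_self_sqrt hN]
        linarith
    rw [← Real.sq_sqrt hN]
    exact pow_le_pow_left₀ (Real.sqrt_nonneg _) hs 2
  calc conjugate G ζ - conjugate G ζ' ≤ ∑ i, Y i * (ζ i - ζ' i) := by linarith
    _ ≤ _ := h4
    _ ≤ _ := by gcongr

/-- Envelope theorem for the conjugate along a curve: its derivative is `⟪Y, ζ'⟫`, where `Y` is
the maximizer, because `s ↦ ⟪Y, ζ s⟫ - Φ(Y)` touches the conjugate from below. -/
theorem eq_of_hasDerivAt_conjugate (hG : G.Connected) {ζ : V → ℝ → ℝ} (hζ : ∀ s, ∑ i, ζ i s = 0)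
    {ζ' : V → ℝ} {t φ' : ℝ} (h : ∀ i, HasDerivAt (ζ i) (ζ' i) t)
    (hφ : HasDerivAt (fun s => conjugate G fun i => ζ i s) φ' t) {Y : V → ℝ}
    (hY : coupling G Y = fun i => ζ i t)
    (hYc : conjugate G (fun i => ζ i t) = 1 / 2 * potential G Y) :
    φ' = ∑ i, Y i * ζ' i := by
  have h1 : HasDerivAt (fun s => conjugate G (fun i => ζ i s) - ∑ i, Y i * ζ i s)
      (φ' - ∑ i, Y i * ζ' i) t :=
    hφ.sub (HasDerivAt.fun_sum fun i _ => (h i).const_mul (Y i))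
  have h2 : IsLocalMin (fun s => conjugate G (fun i => ζ i s) - ∑ i, Y i * ζ i s) t := by
    refine Eventually.of_forall fun s => ?_
    obtain ⟨-, -, -, hle⟩ := exists_coupling_eq hG (hζ s)
    have h3 : ∑ i, Y i * ζ i t = 3 / 2 * potential G Y := by
      rw [← sum_mul_coupling, hY]
    have := hle Y
    dsimp only
    rw [h3, hYc]
    linarith
  exact sub_eq_zero.1 (h2.hasDerivAt_eq_zero h1)

/-! ### The Lyapunov function -/

/-- The Lyapunov function: the Fenchel-Young gap `Φ(X) + Φ*(ζ) - ⟪X, ζ⟫`, which measures the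
distance to the slow manifold `ζ = ∇Φ(X)`, plus a multiple of `Φ*(ζ)`, which decreases along it. -/
noncomputable def lyapunov (G : SimpleGraph V) [DecidableRel G.Adj] (X ζ : V → ℝ) : ℝ :=
  potential G X - ∑ i, X i * ζ i + 3 * conjugate G ζ

theorem two_mul_conjugate_le_lyapunov (hG : G.Connected) (X : V → ℝ) {ζ : V → ℝ}
    (hζ : ∑ i, ζ i = 0) : 2 * conjugate G ζ ≤ lyapunov G X ζ := by
  obtain ⟨-, -, -, hle⟩ := exists_coupling_eq hG hζ
  have := hle X
  unfold lyapunov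
  linarith

theorem lyapunov_nonneg (hG : G.Connected) (X : V → ℝ) {ζ : V → ℝ} (hζ : ∑ i, ζ i = 0) :
    0 ≤ lyapunov G X ζ :=
  le_trans (by linarith [conjugate_nonneg hG hζ]) (two_mul_conjugate_le_lyapunov hG X hζ)

theorem of_lyapunov_eq_zero (hG : G.Connected) {X ζ : V → ℝ} (hζ : ∑ i, ζ i = 0)
    (h : lyapunov G X ζ = 0) : (∀ i j, X i = X j) ∧ ζ = 0 := by
  have h1 := two_mul_conjugate_le_lyapunov hG X hζ
  have h2 : conjugate G ζ = 0 := le_antisymm (by linarith) (conjugate_nonneg hG hζ)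
  have h3 := eq_zero_of_conjugate_eq_zero hG hζ h2
  refine ⟨eq_of_potential_eq_zero hG ?_, h3⟩
  unfold lyapunov at h
  rw [h2, h3] at h
  simpa using h

theorem sq_sum_abs_le (v : V → ℝ) : (∑ i, |v i|) ^ 2 ≤ Fintype.card V * ∑ i, v i ^ 2 := by
  simpa using sq_sum_le_card_mul_sum_sq (s := Finset.univ) (f := fun i => |v i|)

/-- The distance of `X` to the maximizer `Y` in terms of the mismatch of their couplings. -/
theorem edgeNorm_sub_le_add_sq (hG : G.Connected) (X Y : V → ℝ) {A R : ℝ}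
    (hA : A = 2 * (Fintype.card V : ℝ) ^ 3)
    (hR : R = ∑ i, |coupling G Y i - coupling G X i|) :
    edgeNorm G (Y - X) ≤ 4 * A * √(edgeNorm G X) * R + A ^ 2 * R ^ 2 := by
  have h := edgeNorm_sub_le_coupling hG X Y
  rw [← hA, ← hR] at h
  have hR0 : 0 ≤ R := hR ▸ Finset.sum_nonneg fun _ _ => abs_nonneg _
  have hA0 : 0 ≤ A := by rw [hA]; positivity
  set p := √(edgeNorm G X)
  set q := √(edgeNorm G (Y - X)) with hq
  have hs : √(edgeNorm G Y) ≤ p + q :=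
    (Real.sqrt_le_sqrt (edgeNorm_sub_le X Y)).trans (by
      refine Real.sqrt_le_iff.2 ⟨by positivity, ?_⟩
      have h1 := Real.sq_sqrt (edgeNorm_nonneg (G := G) X)
      have h2 := Real.sq_sqrt (edgeNorm_nonneg (G := G) (Y - X))
      have h3 : 0 ≤ p * q := by positivity
      nlinarith)
  have hq2 : edgeNorm G (Y - X) = q ^ 2 := (Real.sq_sqrt (edgeNorm_nonneg _)).symm
  have h1 : A * (p + √(edgeNorm G Y)) * R ≤ A * (p + (p + q)) * R := by gcongr
  rw [hq2] at h ⊢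
  nlinarith [sq_nonneg (q - A * R)]

theorem lyapunov_le (hG : G.Connected) {X Y ζ : V → ℝ} (hζ : ∑ i, ζ i = 0)
    (hY : coupling G Y = ζ) (hYc : conjugate G ζ = 1 / 2 * potential G Y) :
    lyapunov G X ζ ≤ (((Fintype.card V : ℝ) ^ 2 + (1 + 4 * (Fintype.card V : ℝ) ^ 4) ^ 3) *
      √(edgeNorm G X + ∑ i, (ζ i - coupling G X i) ^ 2)) ^ 3 := by
  have hn1 : (1 : ℝ) ≤ Fintype.card V := by
    have := hG.nonempty
    exact_mod_cast Fintype.card_pos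
  set n : ℝ := (Fintype.card V : ℝ) with hn
  set r2 := ∑ i, (ζ i - coupling G X i) ^ 2 with hr2
  have hr20 : 0 ≤ r2 := Finset.sum_nonneg fun _ _ => sq_nonneg _
  set R := ∑ i, |ζ i - coupling G X i| with hR
  have hR0 : 0 ≤ R := Finset.sum_nonneg fun _ _ => abs_nonneg _
  have hRr : R ^ 2 ≤ n * r2 := sq_sum_abs_le _
  have hN0 := edgeNorm_nonneg (G := G) X
  set e := √(edgeNorm G X + r2) with he
  have he0 : 0 ≤ e := Real.sqrt_nonneg _
  have he2 : e ^ 2 = edgeNorm G X + r2 := Real.sq_sqrt (by positivity)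
  have hRe : R ≤ n * e := by
    refine le_of_sq_le_sq ?_ (by positivity)
    calc R ^ 2 ≤ n * r2 := hRr
      _ ≤ n * n * e ^ 2 := by
        rw [he2]
        have : r2 ≤ n * (edgeNorm G X + r2) := by nlinarith
        nlinarith
      _ = _ := by ring
  have hp : √(edgeNorm G X) ≤ e := Real.sqrt_le_sqrt (by linarith)
  have hW := edgeNorm_sub_le_add_sq hG X Y (A := 2 * n ^ 3) (R := R) rfl (by rw [hY])
  set B := 1 + 4 * n ^ 4 with hB
  have hNY : edgeNorm G Y ≤ (B * e) ^ 2 := by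
    calc edgeNorm G Y ≤ edgeNorm G X + edgeNorm G (Y - X) := edgeNorm_sub_le X Y
      _ ≤ e ^ 2 + (4 * (2 * n ^ 3) * e * (n * e) + (2 * n ^ 3) ^ 2 * (n * e) ^ 2) := by
        refine add_le_add (by linarith) (hW.trans ?_)
        gcongr
      _ ≤ (B * e) ^ 2 := by
        have : 0 ≤ n ^ 8 * e ^ 2 := by positivity
        rw [hB]; nlinarith
  have hsY : √(edgeNorm G Y) ≤ B * e := Real.sqrt_le_iff.2 ⟨by positivity, hNY⟩
  have hPY : potential G Y ≤ 1 / 3 * ((B * e) ^ 2 * (B * e)) := by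
    refine (potential_le Y).trans ?_
    gcongr
  have hXζ : -∑ i, X i * ζ i ≤ -(3 / 2 * potential G X) + n * edgeNorm G X * R := by
    have h1 := (neg_abs_le _).trans' (neg_le_neg (abs_sum_mul_le hG X
      (ζ := fun i => ζ i - coupling G X i)
      (by rw [Finset.sum_sub_distrib, hζ, sum_coupling, sub_zero])))
    have h2 : ∑ i, X i * (ζ i - coupling G X i) = ∑ i, X i * ζ i - 3 / 2 * potential G X := by
      simp only [mul_sub, Finset.sum_sub_distrib, sum_mul_coupling]
    rw [h2] at h1
    linarith
  have hNR : n * edgeNorm G X * R ≤ n * e ^ 2 * (n * e) := by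
    gcongr
    linarith
  have hPX := potential_nonneg (G := G) X
  have h1 : lyapunov G X ζ ≤ (n ^ 2 + B ^ 3) * e ^ 3 := by
    unfold lyapunov
    rw [hYc]
    have : 0 ≤ B ^ 3 * e ^ 3 := by positivity
    nlinarith
  have hK : 1 ≤ n ^ 2 + B ^ 3 := by
    have : 0 ≤ B ^ 3 := by positivity
    nlinarith
  calc lyapunov G X ζ ≤ (n ^ 2 + B ^ 3) * e ^ 3 := h1
    _ ≤ (n ^ 2 + B ^ 3) ^ 3 * e ^ 3 := by
      gcongr
      exact le_self_pow₀ hK (by norm_num)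
    _ = _ := by ring

/-! ### Decrease along trajectories -/

/-- The discontinuous part of the dynamics of `ζ`: the signs `σ` on the edges with gain `k₁`, and
the disturbance `d`. -/
def forcing (G : SimpleGraph V) [DecidableRel G.Adj] (k₁ : ℝ) (σ : V → V → ℝ) (d : V → ℝ)
    (i : V) : ℝ := -k₁ * ∑ j ∈ G.neighborFinset i, σ i j + d i

theorem sum_mul_forcing_le {k₁ : ℝ} (hG : G.Connected) (hk : 0 ≤ k₁) {σ : V → V → ℝ}
    {d : V → ℝ} (hσ : ∀ i j, σ j i = -σ i j) (hd : ∑ i, d i = 0) (hd1 : ∀ i, |d i| ≤ 1)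
    (W : V → ℝ) {s : ℝ} (hs : s * edgeNorm G W ≤ edgeSum G fun i j => (W i - W j) * σ i j) :
    ∑ i, W i * forcing G k₁ σ d i ≤
      (-(k₁ / 2 * s) + (Fintype.card V : ℝ) ^ 2) * edgeNorm G W := by
  have h1 : ∑ i, W i * forcing G k₁ σ d i =
      -k₁ * ∑ i, W i * ∑ j ∈ G.neighborFinset i, σ i j + ∑ i, W i * d i := by
    rw [Finset.mul_sum, ← Finset.sum_add_distrib]
    exact Finset.sum_congr rfl fun i _ => by unfold forcing; ring
  have h2 := (le_abs_self _).trans (abs_sum_mul_le hG W hd)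
  have h3 : ∑ i, |d i| ≤ Fintype.card V := by
    simpa using Finset.sum_le_sum fun i (_ : i ∈ Finset.univ) => hd1 i
  have hN := edgeNorm_nonneg (G := G) W
  have h4 : (Fintype.card V : ℝ) * edgeNorm G W * ∑ i, |d i| ≤
      Fintype.card V * edgeNorm G W * Fintype.card V := by gcongr
  have h5 := mul_le_mul_of_nonneg_left hs hk
  rw [h1, sum_mul_sum_neighbor W hσ]
  linarith

/-- The gain `k₁` of the sign terms on a graph with `n` vertices. -/
def signGain (n : ℝ) : ℝ := 2 * (n ^ 2 + 1)

/-- The constant `C`, on a graph with `n` vertices, for which `k₀² ≥ C + 1` is required of the gain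
`k₀` of the square-root terms. -/
def sqrtGainBound (n : ℝ) : ℝ :=
  n * (36 * (2 * n ^ 3) ^ 2 * (2 * n ^ 2 + 1) ^ 2 + 3 * (2 * n ^ 2 + 1) * (2 * n ^ 3) ^ 2)

/-- The contribution of the forcing to the derivative of the Lyapunov function: on the slow
manifold `Y = X` it is negative, and elsewhere the excess is controlled by the mismatch between
`coupling G Y` and `coupling G X`. -/
theorem sum_mul_forcing_signGain_le (hG : G.Connected) {X Y : V → ℝ} {σ : V → V → ℝ} {d : V → ℝ}
    (hσ : ∀ i j, σ j i = -σ i j) (hσX : ∀ i j, G.Adj i j → σ i j ∈ signSet (X i - X j))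
    (hd : ∑ i, d i = 0) (hd1 : ∀ i, |d i| ≤ 1) :
    ∑ i, (3 * Y i - X i) * forcing G (signGain (Fintype.card V)) σ d i ≤
      -edgeNorm G X +
        sqrtGainBound (Fintype.card V) * ∑ i, (coupling G Y i - coupling G X i) ^ 2 := by
  set n : ℝ := (Fintype.card V : ℝ) with hn
  have hn0 : 0 ≤ n := Nat.cast_nonneg _
  have hk : 0 ≤ signGain n := by unfold signGain; positivity
  have h1 := sum_mul_forcing_le hG hk hσ hd hd1 X (s := 1) (by
    rw [one_mul, edgeNorm]
    refine (edgeSum_congr fun i j hij => ?_).le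
    obtain ⟨hp, hm, -⟩ := hσX i j hij
    rcases lt_trichotomy (X i - X j) 0 with h | h | h
    · rw [hm h, abs_of_neg h]; ring
    · rw [h]; simp
    · rw [hp h, abs_of_pos h]; ring)
  have h2 := sum_mul_forcing_le hG hk hσ hd hd1 (Y - X) (s := -1) (by
    rw [edgeNorm, ← edgeSum_mul_left]
    refine edgeSum_le_edgeSum fun i j hij => ?_
    have h : |σ i j| ≤ 1 := abs_le.2 (hσX i j hij).2.2
    have := mul_le_mul_of_nonneg_left h (abs_nonneg ((Y - X) i - (Y - X) j))
    rw [← abs_mul] at this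
    linarith [neg_abs_le (((Y - X) i - (Y - X) j) * σ i j)])
  have h3 : ∑ i, (3 * Y i - X i) * forcing G (signGain n) σ d i =
      2 * ∑ i, X i * forcing G (signGain n) σ d i +
      3 * ∑ i, (Y - X) i * forcing G (signGain n) σ d i := by
    rw [Finset.mul_sum, Finset.mul_sum, ← Finset.sum_add_distrib]
    exact Finset.sum_congr rfl fun i _ => by simp only [Pi.sub_apply]; ring
  have hW := edgeNorm_sub_le_add_sq hG X Y rfl rfl
  have hR := sq_sum_abs_le fun i => coupling G Y i - coupling G X i
  rw [← hn] at h1 h2 hW hR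
  rw [h3]
  set R := ∑ i, |coupling G Y i - coupling G X i|
  have hp := Real.sq_sqrt (edgeNorm_nonneg (G := G) X)
  set p := √(edgeNorm G X)
  have e1 : -(signGain n / 2 * 1) + n ^ 2 = -1 := by unfold signGain; ring
  have e2 : -(signGain n / 2 * -1) + n ^ 2 = 2 * n ^ 2 + 1 := by unfold signGain; ring
  rw [e1] at h1
  rw [e2] at h2
  unfold sqrtGainBound
  set M := 2 * n ^ 2 + 1 with hM
  have hM0 : 0 ≤ M := by positivity
  set A := 2 * n ^ 3
  set r2 := ∑ i, (coupling G Y i - coupling G X i) ^ 2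
  have h4 := mul_le_mul_of_nonneg_left hW hM0
  have h5 : (36 * A ^ 2 * M ^ 2 + 3 * M * A ^ 2) * R ^ 2 ≤
      (36 * A ^ 2 * M ^ 2 + 3 * M * A ^ 2) * (n * r2) := by gcongr
  -- Young's inequality absorbs the cross term `12 A M p R` into `p² = edgeNorm G X`.
  nlinarith [sq_nonneg (p - 6 * A * M * R)]

/-- The derivative of the Lyapunov function along the dynamics. The damping `γ` only helps, by
Fenchel's inequality at `X / 4`. -/
theorem lyapunov_deriv_le (hG : G.Connected) {γ ρ k₀ : ℝ} (hγ : 0 ≤ γ) (hρ : 0 ≤ ρ) (hk₀ : 0 < k₀)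
    (hk : sqrtGainBound (Fintype.card V) + 1 ≤ k₀ ^ 2)
    {X Y ζ : V → ℝ} {σ : V → V → ℝ} {d : V → ℝ}
    (hσ : ∀ i j, σ j i = -σ i j) (hσX : ∀ i j, G.Adj i j → σ i j ∈ signSet (X i - X j))
    (hd : ∑ i, d i = 0) (hd1 : ∀ i, |d i| ≤ 1) (hY : coupling G Y = ζ)
    (hYc : conjugate G ζ = 1 / 2 * potential G Y)
    (hle : ∀ Z : V → ℝ, ∑ i, Z i * ζ i - potential G Z ≤ conjugate G ζ)
    {X' ζ' : V → ℝ} (hX' : ∀ i, X' i = -γ * X i + ρ * (ζ i - coupling G X i))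
    (hζ' : ∀ i, ζ' i =
      -γ * ζ i + ρ / k₀ ^ 2 * forcing G (signGain (Fintype.card V)) σ d i) :
    ∑ i, X' i * coupling G X i - ∑ i, (X' i * ζ i + X i * ζ' i) + 3 * ∑ i, Y i * ζ' i ≤
      -(ρ / k₀ ^ 2) * (edgeNorm G X + ∑ i, (ζ i - coupling G X i) ^ 2) := by
  have h1 := sum_mul_forcing_signGain_le hG (Y := Y) hσ hσX hd hd1
  rw [hY] at h1
  set g := forcing G (signGain (Fintype.card V)) σ d
  set C := sqrtGainBound (Fintype.card V)
  set r2 := ∑ i, (ζ i - coupling G X i) ^ 2 with hr2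
  have hr20 : 0 ≤ r2 := Finset.sum_nonneg fun _ _ => sq_nonneg _
  have e : ∑ i, X' i * coupling G X i - ∑ i, (X' i * ζ i + X i * ζ' i) + 3 * ∑ i, Y i * ζ' i =
      -γ * (∑ i, X i * coupling G X i - 2 * ∑ i, X i * ζ i + 3 * ∑ i, Y i * ζ i) - ρ * r2 +
      ρ / k₀ ^ 2 * ∑ i, (3 * Y i - X i) * g i := by
    simp only [hr2, Finset.mul_sum, ← Finset.sum_sub_distrib, ← Finset.sum_add_distrib]
    refine Finset.sum_congr rfl fun i _ => ?_
    rw [hX', hζ']; ring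
  -- The damping term, nonnegative since the coefficient `3` of the conjugate exceeds `8 / 3`.
  have hD : 0 ≤ ∑ i, X i * coupling G X i - 2 * ∑ i, X i * ζ i + 3 * ∑ i, Y i * ζ i := by
    rw [sum_mul_coupling, ← hY, sum_mul_coupling, hY]
    have h2 := hle fun i => 1 / 4 * X i
    have h3 : potential G (fun i => 1 / 4 * X i) = 1 / 8 * potential G X := by
      unfold potential
      have : ∀ u : ℝ, |1 / 4 * u| * √|1 / 4 * u| = 1 / 8 * (|u| * √|u|) := fun u => by
        rw [abs_mul, abs_of_pos (by norm_num : (0 : ℝ) < 1 / 4), Real.sqrt_mul (by norm_num),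
          show (1 / 4 : ℝ) = (1 / 2) ^ 2 by norm_num, Real.sqrt_sq (by norm_num)]
        ring
      simp only [← mul_sub, this, edgeSum_mul_left]
      ring
    have h4 : ∑ i, 1 / 4 * X i * ζ i = 1 / 4 * ∑ i, X i * ζ i := by
      rw [Finset.mul_sum]
      exact Finset.sum_congr rfl fun i _ => by ring
    rw [h3, h4, hYc] at h2
    linarith [potential_nonneg (G := G) X, potential_nonneg (G := G) Y]
  have hε : 0 ≤ ρ / k₀ ^ 2 := by positivity
  have h5 := mul_le_mul_of_nonneg_left h1 hε
  have h6 : ρ * r2 = ρ / k₀ ^ 2 * (k₀ ^ 2 * r2) := by field_simp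
  have h7 : ρ / k₀ ^ 2 * ((C + 1) * r2) ≤ ρ / k₀ ^ 2 * (k₀ ^ 2 * r2) := by gcongr
  have h8 := mul_nonneg hγ hD
  rw [e, h6]
  linarith

/-- The settling time, as a function of the initial value `v` of the Lyapunov function, on a graph
with `n` vertices. -/
noncomputable def settlingTime (n ρ k₀ v : ℝ) : ℝ :=
  3 * (n ^ 2 + (1 + 4 * n ^ 4) ^ 3) ^ 2 / (ρ / k₀ ^ 2) * v ^ (1 / 3 : ℝ)

/-- Finite-time stability of the normalized consensus error dynamics. -/
theorem finite_time_consensus (hG : G.Connected) {γ ρ k₀ : ℝ} (hγ : 0 ≤ γ) (hρ : 0 < ρ)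
    (hk₀ : 0 < k₀) (hk : sqrtGainBound (Fintype.card V) + 1 ≤ k₀ ^ 2)
    {X ζ : V → ℝ → ℝ} (hX : ∀ i, ∀ T, 0 ≤ T → AbsolutelyContinuousOnInterval (X i) 0 T)
    (hζ : ∀ i, ∀ T, 0 ≤ T → AbsolutelyContinuousOnInterval (ζ i) 0 T)
    (hζ0 : ∀ t, ∑ i, ζ i t = 0)
    (hdyn : ∀ᵐ t ∂(volume.restrict (Ici (0 : ℝ))), ∃ (σ : V → V → ℝ) (d : V → ℝ),
      (∀ i j, σ j i = -σ i j) ∧ (∀ i j, G.Adj i j → σ i j ∈ signSet (X i t - X j t)) ∧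
      ∑ i, d i = 0 ∧ (∀ i, |d i| ≤ 1) ∧
      (∀ i, HasDerivAt (X i)
        (-γ * X i t + ρ * (ζ i t - coupling G (fun i => X i t) i)) t) ∧
      ∀ i, HasDerivAt (ζ i)
        (-γ * ζ i t + ρ / k₀ ^ 2 * forcing G (signGain (Fintype.card V)) σ d i) t)
    {t : ℝ} (ht : settlingTime (Fintype.card V) ρ k₀
      (lyapunov G (fun i => X i 0) fun i => ζ i 0) < t) :
    (∀ i j, X i t = X j t) ∧ ∀ i, ζ i t = 0 := by
  have hφac : ∀ T, 0 ≤ T →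
      AbsolutelyContinuousOnInterval (fun s => conjugate G fun i => ζ i s) 0 T := by
    intro T hT
    obtain ⟨B, hB⟩ := (AbsolutelyContinuousOnInterval.of_abs_sub_le_sum
      (g := fun s => ∑ i, |ζ i s|) (C := 1) (fun i => hζ i T hT) fun x _ y _ => by
        rw [one_mul, ← Finset.sum_sub_distrib]
        exact (Finset.abs_sum_le_sum_abs _ _).trans
          (Finset.sum_le_sum fun i _ => abs_abs_sub_abs_le_abs_sub _ _)).exists_bound
    have hle : ∀ x ∈ uIcc 0 T, ∀ y,
        conjugate G (fun i => ζ i x) - conjugate G (fun i => ζ i y) ≤ Fintype.card V *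
          (2 * (Fintype.card V : ℝ) ^ 3 * B) ^ 2 * ∑ i, |ζ i x - ζ i y| := by
      intro x hx y
      have h0 : 0 ≤ ∑ i, |ζ i x| := Finset.sum_nonneg fun _ _ => abs_nonneg _
      have h1 : ∑ i, |ζ i x| ≤ B := (le_abs_self _).trans (hB x hx)
      refine (conjugate_sub_le hG (hζ0 x) (hζ0 y)).trans ?_
      gcongr
    refine AbsolutelyContinuousOnInterval.of_abs_sub_le_sum (fun i => hζ i T hT)
      fun x hx y hy => abs_sub_le_iff.2 ⟨hle x hx y, ?_⟩
    simpa only [abs_sub_comm] using hle y hy x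
  have hPac : ∀ T, 0 ≤ T →
      AbsolutelyContinuousOnInterval (fun s => potential G fun i => X i s) 0 T := by
    intro T hT
    refine (AbsolutelyContinuousOnInterval.finset_sum _ fun i _ =>
      AbsolutelyContinuousOnInterval.finset_sum _ fun j _ => ?_).const_mul _
    have hu := (hX i T hT).fun_sub (hX j T hT)
    obtain ⟨B, hB⟩ := hu.exists_bound
    refine AbsolutelyContinuousOnInterval.of_abs_sub_le_sum (ι := Unit) (C := √B + √B)
      (fun _ => hu) fun x hx y hy => (abs_abs_mul_sqrt_abs_sub_le _ _).trans ?_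
    rw [Fintype.sum_unique]
    gcongr
    · exact hB x hx
    · exact hB y hy
  have hVac : ∀ T, 0 ≤ T → AbsolutelyContinuousOnInterval
      (fun s => lyapunov G (fun i => X i s) fun i => ζ i s) 0 T := fun T hT =>
    ((hPac T hT).fun_sub (AbsolutelyContinuousOnInterval.finset_sum _ fun i _ =>
      (hX i T hT).fun_mul (hζ i T hT))).fun_add ((hφac T hT).const_mul 3)
  have hzero := eq_zero_of_deriv_le (κ := ρ / k₀ ^ 2)
    (K := (Fintype.card V : ℝ) ^ 2 + (1 + 4 * (Fintype.card V : ℝ) ^ 4) ^ 3)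
    (by positivity) (by positivity) hVac (fun t => lyapunov_nonneg hG _ (hζ0 t)) (by
      filter_upwards [hdyn, AbsolutelyContinuousOnInterval.ae_restrict_Ici_differentiableAt hφac]
        with s ⟨σ, d, hσ, hσX, hd, hd1, hX', hζ'⟩ hφ
      obtain ⟨Y, hY, hYc, hle⟩ := exists_coupling_eq hG (hζ0 s)
      have hφ' := hφ.hasDerivAt
      rw [eq_of_hasDerivAt_conjugate hG hζ0 hζ' hφ' hY hYc] at hφ'
      refine ⟨_, ((hasDerivAt_potential hX').sub (HasDerivAt.fun_sum fun i _ =>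
        (hX' i).mul (hζ' i))).add (hφ'.const_mul 3), _, Real.sqrt_nonneg _,
        lyapunov_le hG (hζ0 s) hY hYc, ?_⟩
      rw [Real.sq_sqrt (add_nonneg (edgeNorm_nonneg _) (Finset.sum_nonneg fun _ _ => sq_nonneg _))]
      exact lyapunov_deriv_le hG hγ hρ.le hk₀ hk hσ hσX hd hd1 hY hYc hle (fun _ => rfl)
        fun _ => rfl) ht
  obtain ⟨h1, h2⟩ := of_lyapunov_eq_zero hG (hζ0 t) hzero
  exact ⟨h1, fun i => congrFun h2 i⟩

end Redcho

namespace Redcho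

/-! ### Averages and deviations -/

section Average

variable {N : ℕ}

/-- The deviation `fᵢ - f̄` of a family of signals from its average. -/
noncomputable def dev (f : Fin N → ℝ → ℝ) (i : Fin N) (t : ℝ) : ℝ := f i t - avg f t

theorem sum_dev [NeZero N] (f : Fin N → ℝ → ℝ) (t : ℝ) : ∑ i, dev f i t = 0 := by
  have : (N : ℝ) ≠ 0 := Nat.cast_ne_zero.2 (NeZero.ne N)
  simp only [dev, avg, Finset.sum_sub_distrib, Finset.sum_const, Finset.card_univ,
    Fintype.card_fin, nsmul_eq_mul]
  field_simp
  ring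

theorem hasDerivAt_avg {f : Fin N → ℝ → ℝ} {f' : Fin N → ℝ} {t : ℝ}
    (h : ∀ i, HasDerivAt (f i) (f' i) t) : HasDerivAt (avg f) (1 / (N : ℝ) * ∑ i, f' i) t :=
  (HasDerivAt.fun_sum fun i _ => h i).const_mul _

theorem hasDerivAt_dev {f : Fin N → ℝ → ℝ} {f' : Fin N → ℝ} {t : ℝ}
    (h : ∀ i, HasDerivAt (f i) (f' i) t) (i : Fin N) :
    HasDerivAt (dev f i) (f' i - 1 / (N : ℝ) * ∑ j, f' j) t :=
  (h i).sub (hasDerivAt_avg h)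

theorem absolutelyContinuousOnInterval_avg {f : Fin N → ℝ → ℝ} {a b : ℝ}
    (h : ∀ i, AbsolutelyContinuousOnInterval (f i) a b) :
    AbsolutelyContinuousOnInterval (avg f) a b :=
  (AbsolutelyContinuousOnInterval.finset_sum _ fun i _ => h i).const_mul _

theorem absolutelyContinuousOnInterval_dev {f : Fin N → ℝ → ℝ} {a b : ℝ}
    (h : ∀ i, AbsolutelyContinuousOnInterval (f i) a b) (i : Fin N) :
    AbsolutelyContinuousOnInterval (dev f i) a b :=
  (h i).fun_sub (absolutelyContinuousOnInterval_avg h)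

theorem hasDerivWithinAt_avg {f : Fin N → ℝ → ℝ} {f' : Fin N → ℝ} {S : Set ℝ} {t : ℝ}
    (h : ∀ i, HasDerivWithinAt (f i) (f' i) S t) :
    HasDerivWithinAt (avg f) (1 / (N : ℝ) * ∑ i, f' i) S t :=
  (HasDerivWithinAt.fun_sum fun i _ => h i).const_mul _

theorem hasDerivWithinAt_dot {f : ℝ → ℝ} (hf : DifferentiableOn ℝ f (Ici 0)) {t : ℝ}
    (ht : 0 ≤ t) : HasDerivWithinAt f (dot f t) (Ici 0) t :=
  (hf t ht).hasDerivWithinAt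

theorem hasDerivAt_dot {f : ℝ → ℝ} (hf : DifferentiableOn ℝ f (Ici 0)) {t : ℝ} (ht : 0 < t) :
    HasDerivAt f (dot f t) t :=
  (hasDerivWithinAt_dot hf ht.le).hasDerivAt (Ici_mem_nhds ht)

theorem dot_avg {f : Fin N → ℝ → ℝ} (hf : ∀ i, DifferentiableOn ℝ (f i) (Ici 0)) {t : ℝ}
    (ht : 0 ≤ t) : dot (avg f) t = avg (fun i => dot (f i)) t :=
  (hasDerivWithinAt_avg fun i => hasDerivWithinAt_dot (hf i) ht).derivWithin
    (uniqueDiffOn_Ici 0 t ht)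

theorem dot_dot_avg {s : Fin N → ℝ → ℝ} (hs : ∀ i, TwiceDifferentiable (s i)) {t : ℝ}
    (ht : 0 ≤ t) : dot (dot (avg s)) t = avg (fun i => dot (dot (s i))) t := by
  rw [← dot_avg (fun i => (hs i).2) ht]
  exact derivWithin_congr (fun x hx => dot_avg (fun i => (hs i).1) hx)
    (dot_avg (fun i => (hs i).1) ht)

theorem absolutelyContinuousOnInterval_of_abs_deriv_le {f f' : ℝ → ℝ} {T C : ℝ} (hT : 0 ≤ T)
    (hf : ∀ t ∈ Icc 0 T, HasDerivWithinAt f (f' t) (Ici 0) t) (hC : ∀ t ∈ Icc 0 T, |f' t| ≤ C) :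
    AbsolutelyContinuousOnInterval f 0 T := by
  refine AbsolutelyContinuousOnInterval.of_abs_sub_le_sum (ι := Unit) (f := fun _ t => t) (C := C)
    (fun _ => ?_) fun x hx y hy => ?_
  · exact (contDiff_id.contDiffOn).absolutelyContinuousOnInterval
  · rw [uIcc_of_le hT] at hx hy
    rw [Fintype.sum_unique]
    exact (convex_Icc 0 T).norm_image_sub_le_of_norm_hasDerivWithin_le
      (fun t ht => (hf t ht).mono Icc_subset_Ici_self) hC hy hx

variable {s : Fin N → ℝ → ℝ} {γ L : ℝ}

theorem TwiceDifferentiable.absolutelyContinuousOnInterval {f : ℝ → ℝ}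
    (hf : TwiceDifferentiable f) {T : ℝ} (hT : 0 ≤ T) :
    AbsolutelyContinuousOnInterval f 0 T := by
  obtain ⟨C, hC⟩ := isCompact_Icc.exists_bound_of_continuousOn
    (hf.2.continuousOn.mono (Icc_subset_Ici_self : Icc 0 T ⊆ Ici 0))
  exact absolutelyContinuousOnInterval_of_abs_deriv_le hT
    (fun t ht => hasDerivWithinAt_dot hf.1 ht.1) hC

/-- The quantity `sᵢ'' + 2 γ sᵢ' + γ² sᵢ`, whose deviations the mismatch assumption bounds. -/
noncomputable def mismatchSignal (γ : ℝ) (s : Fin N → ℝ → ℝ) (i : Fin N) (t : ℝ) : ℝ :=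
  dot (dot (s i)) t + 2 * γ * dot (s i) t + γ ^ 2 * s i t

theorem dev_mismatchSignal (i : Fin N) (t : ℝ) :
    dev (mismatchSignal γ s) i t = dev (fun i => dot (dot (s i))) i t +
      2 * γ * dev (fun i => dot (s i)) i t + γ ^ 2 * dev s i t := by
  simp only [dev, avg, mismatchSignal, Finset.sum_add_distrib, ← Finset.mul_sum]
  ring

theorem BoundedMismatch.abs_dev_le (hs : ∀ i, TwiceDifferentiable (s i))
    (hb : BoundedMismatch s γ L) (hL : 0 < L) (i : Fin N) {t : ℝ} (ht : 0 ≤ t) :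
    |dev (mismatchSignal γ s) i t| ≤ L := by
  have h := hb i t ht
  rw [dot_dot_avg hs ht, dot_avg (fun i => (hs i).1) ht, ← abs_neg] at h
  rw [dev_mismatchSignal]
  unfold dev
  have hN : 1 ≤ √(N : ℝ) := by
    have : NeZero N := ⟨fun h => by subst h; exact i.elim0⟩
    rw [Real.one_le_sqrt]
    exact_mod_cast NeZero.one_le
  calc _ = _ := by congr 1; ring
    _ ≤ L / √(N : ℝ) := h
    _ ≤ L := div_le_self hL.le hN

/-- The derivatives `sᵢ'` need not be absolutely continuous, but their deviations are locally
Lipschitz by the mismatch assumption. -/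
theorem BoundedMismatch.absolutelyContinuousOnInterval_dev_dot
    (hs : ∀ i, TwiceDifferentiable (s i)) (hb : BoundedMismatch s γ L) (hL : 0 < L) (i : Fin N)
    {T : ℝ} (hT : 0 ≤ T) :
    AbsolutelyContinuousOnInterval (dev (fun i => dot (s i)) i) 0 T := by
  have hsub : Icc 0 T ⊆ Ici (0 : ℝ) := Icc_subset_Ici_self
  have hc : ContinuousOn (fun t => 2 * γ * dev (fun i => dot (s i)) i t + γ ^ 2 * dev s i t)
      (Icc 0 T) := by
    have h1 : ∀ i, ContinuousOn (s i) (Icc 0 T) := fun i => (hs i).1.continuousOn.mono hsub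
    have h2 : ∀ i, ContinuousOn (dot (s i)) (Icc 0 T) := fun i => (hs i).2.continuousOn.mono hsub
    unfold dev avg
    fun_prop
  obtain ⟨C, hC⟩ := isCompact_Icc.exists_bound_of_continuousOn hc
  refine absolutelyContinuousOnInterval_of_abs_deriv_le (C := L + C) hT
    (f' := dev (fun i => dot (dot (s i))) i) (fun t ht =>
      (hasDerivWithinAt_dot (hs i).2 ht.1).sub
        (hasDerivWithinAt_avg fun i => hasDerivWithinAt_dot (hs i).2 ht.1)) fun t ht => ?_
  have h1 := abs_le.1 (hb.abs_dev_le hs hL i ht.1)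
  have h2 := abs_le.1 (hC t ht)
  rw [dev_mismatchSignal] at h1
  exact abs_le.2 ⟨by linarith, by linarith⟩

end Average

/-! ### Consensus of the trajectories of the protocol -/

section Trajectory

variable {N : ℕ} {G : SimpleGraph (Fin N)} [DecidableRel G.Adj] {k₀ k₁ γ L : ℝ}
  {s η₀ η₁ : Fin N → ℝ → ℝ} {a b : Fin N → ℝ}

/-- The variable `(sᵢ' + γ sᵢ - η_{i,1}) / ρ`, which satisfies
`ŝ_{i,0}' = -γ ŝ_{i,0} + ρ (slowᵢ - coupling)` for `ρ = k₀ √L`. -/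
noncomputable def slow (γ ρ : ℝ) (s η₁ : Fin N → ℝ → ℝ) (i : Fin N) (t : ℝ) : ℝ :=
  (dot (s i) t + γ * s i t - η₁ i t) / ρ

theorem dev_slow (ρ : ℝ) (i : Fin N) (t : ℝ) : dev (slow γ ρ s η₁) i t =
    ρ⁻¹ * (dev (fun i => dot (s i)) i t + γ * dev s i t - dev η₁ i t) := by
  simp only [dev, avg, slow, ← Finset.sum_div, Finset.sum_sub_distrib, Finset.sum_add_distrib,
    ← Finset.mul_sum]
  ring

theorem dev_est0 (i : Fin N) (t : ℝ) : dev (est0 s η₀) i t = dev s i t - dev η₀ i t := by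
  simp only [dev, avg, est0, Finset.sum_sub_distrib]
  ring

theorem coupling_dev_est0 (t : ℝ) (i : Fin N) :
    coupling G (fun i => dev (est0 s η₀) i t) i = coupling G (fun i => est0 s η₀ i t) i := by
  simp [coupling, dev]

theorem est1_eq {ρ : ℝ} (hρ : ρ ≠ 0) (i : Fin N) (t : ℝ) :
    est1 γ s η₀ η₁ i t = ρ * slow γ ρ s η₁ i t - γ * est0 s η₀ i t := by
  unfold est1 slow est0
  field_simp
  ring

/-- The deviations of the estimates follow the normalized consensus error dynamics. -/
theorem IsTrajectory.ae_hasDerivAt_dev [NeZero N]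
    (h : IsTrajectory G k₀ k₁ γ L s a b η₀ η₁) (hL : 0 < L) (hk₀ : 0 < k₀)
    (hs : ∀ i, TwiceDifferentiable (s i)) (hb : BoundedMismatch s γ L) :
    ∀ᵐ t ∂(volume.restrict (Ici (0 : ℝ))), ∃ (σ : Fin N → Fin N → ℝ) (d : Fin N → ℝ),
      (∀ i j, σ j i = -σ i j) ∧
      (∀ i j, G.Adj i j → σ i j ∈ signSet (dev (est0 s η₀) i t - dev (est0 s η₀) j t)) ∧
      ∑ i, d i = 0 ∧ (∀ i, |d i| ≤ 1) ∧
      (∀ i, HasDerivAt (dev (est0 s η₀) i) (-γ * dev (est0 s η₀) i t + k₀ * √L *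
        (dev (slow γ (k₀ * √L) s η₁) i t - coupling G (fun i => dev (est0 s η₀) i t) i)) t) ∧
      ∀ i, HasDerivAt (dev (slow γ (k₀ * √L) s η₁) i)
        (-γ * dev (slow γ (k₀ * √L) s η₁) i t + k₀ * √L / k₀ ^ 2 * forcing G k₁ σ d i) t := by
  have hsL : 0 < √L := Real.sqrt_pos.2 hL
  have hsL2 : √L * √L = L := Real.mul_self_sqrt hL.le
  have hpos : ∀ᵐ t ∂(volume.restrict (Ici (0 : ℝ))), 0 < t := by
    rw [← restrict_Ioi_eq_restrict_Ici]
    exact ae_restrict_mem measurableSet_Ioi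
  filter_upwards [h.dynamics, hpos] with t ⟨σ, hσ, hσX, hη⟩ ht
  refine ⟨σ, fun i => dev (mismatchSignal γ s) i t / L, hσ, fun i j hij => ?_, ?_, fun i => ?_,
    fun i => ?_, fun i => ?_⟩
  · simpa [dev] using hσX i j hij
  · rw [← Finset.sum_div, sum_dev, zero_div]
  · rw [abs_div, abs_of_pos hL, div_le_one hL]
    exact hb.abs_dev_le hs hL i ht.le
  · have hd : ∀ i, HasDerivAt (est0 s η₀ i) (-γ * est0 s η₀ i t + k₀ * √L *
        slow γ (k₀ * √L) s η₁ i t - k₀ * √L * coupling G (fun i => est0 s η₀ i t) i) t := by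
      intro i
      refine ((hasDerivAt_dot (hs i).1 ht).sub (hη i).1).congr_deriv ?_
      unfold slow est0 coupling
      field_simp
      ring
    refine (hasDerivAt_dev hd i).congr_deriv ?_
    rw [coupling_dev_est0]
    simp only [dev, avg, Finset.sum_sub_distrib, Finset.sum_add_distrib, ← Finset.mul_sum,
      sum_coupling]
    ring
  · have hd : ∀ i, HasDerivAt (slow γ (k₀ * √L) s η₁ i) (-γ * slow γ (k₀ * √L) s η₁ i t +
        (k₀ * √L)⁻¹ * (mismatchSignal γ s i t - k₁ * L * ∑ j ∈ G.neighborFinset i, σ i j)) t := by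
      intro i
      refine ((((hasDerivAt_dot (hs i).2 ht).add ((hasDerivAt_dot (hs i).1 ht).const_mul γ)).sub
        (hη i).2).div_const (k₀ * √L)).congr_deriv ?_
      unfold slow mismatchSignal
      field_simp
      ring
    refine (hasDerivAt_dev hd i).congr_deriv ?_
    simp only [dev, avg, Finset.sum_sub_distrib, Finset.sum_add_distrib, ← Finset.mul_sum,
      sum_sum_neighbor_eq_zero hσ, forcing]
    field_simp
    linear_combination (k₁ * L * ∑ j ∈ G.neighborFinset i, σ i j -
      (mismatchSignal γ s i t - (∑ x, mismatchSignal γ s x t) / N)) * hsL2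

/-- Finite-time consensus of the estimates, at a time that depends on the initial values only. -/
theorem exists_consensus_time [NeZero N] (hG : G.Connected) (hγ : 0 ≤ γ) (hL : 0 < L)
    (hk₀ : 0 < k₀) (hk : sqrtGainBound N + 1 ≤ k₀ ^ 2)
    (hs : ∀ i, TwiceDifferentiable (s i)) (hb : BoundedMismatch s γ L) (a b : Fin N → ℝ) :
    ∃ T : ℝ, 0 ≤ T ∧ ∀ η₀ η₁ : Fin N → ℝ → ℝ,
      IsTrajectory G k₀ (signGain N) γ L s a b η₀ η₁ → ∀ i j : Fin N, ∀ t : ℝ, T ≤ t →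
        est0 s η₀ i t = est0 s η₀ j t ∧ est1 γ s η₀ η₁ i t = est1 γ s η₀ η₁ j t := by
  have hρ : 0 < k₀ * √L := mul_pos hk₀ (Real.sqrt_pos.2 hL)
  refine ⟨max 0 (settlingTime N (k₀ * √L) k₀
    (lyapunov G (fun i => dev (est0 s fun i _ => a i) i 0)
      fun i => dev (slow γ (k₀ * √L) s fun i _ => b i) i 0) + 1), le_max_left _ _, ?_⟩
  intro η₀ η₁ h i j t ht
  have hcard : (Fintype.card (Fin N) : ℝ) = N := by simp
  have ht' := lt_of_lt_of_le (lt_add_one _) ((le_max_right _ _).trans ht)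
  have e₀ : ∀ i, dev (est0 s fun i _ => a i) i 0 = dev (est0 s η₀) i 0 := fun i => by
    simp only [dev, avg, est0, h.init₀]
  have e₁ : ∀ i, dev (slow γ (k₀ * √L) s fun i _ => b i) i 0 =
      dev (slow γ (k₀ * √L) s η₁) i 0 := fun i => by
    simp only [dev, avg, slow, h.init₁]
  simp only [e₀, e₁] at ht'
  obtain ⟨h0, h1⟩ := finite_time_consensus hG hγ hρ hk₀ (by rwa [hcard])
    (X := dev (est0 s η₀)) (ζ := dev (slow γ (k₀ * √L) s η₁))
    (fun i T hT => by
      have := (absolutelyContinuousOnInterval_dev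
        (fun i => (hs i).absolutelyContinuousOnInterval hT) i).fun_sub
        (absolutelyContinuousOnInterval_dev (fun i => h.ac₀ i T hT) i)
      simpa only [← dev_est0] using this)
    (fun i T hT => by
      have := (((hb.absolutelyContinuousOnInterval_dev_dot hs hL i hT).fun_add
        ((absolutelyContinuousOnInterval_dev
          (fun i => (hs i).absolutelyContinuousOnInterval hT) i).const_mul γ)).fun_sub
        (absolutelyContinuousOnInterval_dev (fun i => h.ac₁ i T hT) i)).const_mul (k₀ * √L)⁻¹
      simpa only [← dev_slow] using this)
    (sum_dev _) (by rw [hcard]; exact h.ae_hasDerivAt_dev hL hk₀ hs hb)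
    (t := t) (by rwa [hcard])
  have h2 : est0 s η₀ i t = est0 s η₀ j t := by
    have := h0 i j
    unfold dev at this
    linarith
  have h3 : slow γ (k₀ * √L) s η₁ i t = slow γ (k₀ * √L) s η₁ j t := by
    have := (h1 i).trans (h1 j).symm
    unfold dev at this
    linarith
  exact ⟨h2, by rw [est1_eq hρ.ne', est1_eq hρ.ne', h2, h3]⟩

/-! ### Dynamics of the averages -/

/-- The couplings cancel in the averages of the protocol states, which therefore follow a linear
system with explicit solution. -/
theorem IsTrajectory.avg_eq (h : IsTrajectory G k₀ k₁ γ L s a b η₀ η₁) {t : ℝ} (ht : 0 ≤ t) :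
    avg η₁ t = Real.exp (-γ * t) * (1 / N * ∑ i, b i) ∧
    avg η₀ t = Real.exp (-γ * t) * (1 / N * ∑ i, a i + t * (1 / N * ∑ i, b i)) := by
  have hexp : ∀ T : ℝ, AbsolutelyContinuousOnInterval (fun t => Real.exp (γ * t)) 0 T := fun T =>
    (by fun_prop : ContDiff ℝ 1 fun t => Real.exp (γ * t)).contDiffOn.absolutelyContinuousOnInterval
  have hexp' : ∀ t : ℝ, HasDerivAt (fun t => Real.exp (γ * t)) (Real.exp (γ * t) * γ) t := fun t =>
    by simpa using ((hasDerivAt_id t).const_mul γ).exp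
  have hcancel : ∀ t x y : ℝ, Real.exp (γ * t) * x = y → x = Real.exp (-γ * t) * y := by
    rintro t x y rfl
    rw [← mul_assoc, ← Real.exp_add]
    simp
  have hdyn : ∀ᵐ t ∂(volume.restrict (Ici (0 : ℝ))),
      HasDerivAt (avg η₀) (avg η₁ t - γ * avg η₀ t) t ∧ HasDerivAt (avg η₁) (-γ * avg η₁ t) t := by
    filter_upwards [h.dynamics] with t ⟨σ, hσ, _, hη⟩
    refine ⟨(hasDerivAt_avg fun i => (hη i).1).congr_deriv ?_,
      (hasDerivAt_avg fun i => (hη i).2).congr_deriv ?_⟩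
    · have := sum_coupling (G := G) fun i => est0 s η₀ i t
      unfold coupling at this
      simp only [avg, Finset.sum_sub_distrib, Finset.sum_add_distrib, ← Finset.mul_sum, this]
      ring
    · simp only [avg, Finset.sum_sub_distrib, ← Finset.mul_sum, sum_sum_neighbor_eq_zero hσ]
      ring
  have h1 : ∀ t, 0 ≤ t → Real.exp (γ * t) * avg η₁ t = 1 / N * ∑ i, b i := by
    intro t ht
    obtain ⟨C, hC⟩ := ((hexp t).fun_mul (absolutelyContinuousOnInterval_avg
      fun i => h.ac₁ i t ht)).const_of_ae_hasDerivAt_zero (by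
        rw [uIcc_of_le ht]
        filter_upwards [ae_Icc_of_ae_Ici hdyn le_rfl t] with x hx hm
        exact ((hexp' x).mul (hx hm).2).congr_deriv (by ring))
    have h0 := hC 0 left_mem_uIcc
    rw [hC t right_mem_uIcc, ← h0]
    simp [avg, h.init₁]
  refine ⟨hcancel _ _ _ (h1 t ht), hcancel _ _ _ ?_⟩
  set B := 1 / (N : ℝ) * ∑ i, b i
  obtain ⟨C, hC⟩ := (((hexp t).fun_mul (absolutelyContinuousOnInterval_avg
    fun i => h.ac₀ i t ht)).fun_sub ((contDiff_id.contDiffOn (n := 1)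
      (s := uIcc 0 t)).absolutelyContinuousOnInterval.const_mul B)).const_of_ae_hasDerivAt_zero (by
        rw [uIcc_of_le ht]
        filter_upwards [ae_Icc_of_ae_Ici hdyn le_rfl t] with x hx hm
        refine (((hexp' x).mul (hx hm).1).sub ((hasDerivAt_id x).const_mul B)).congr_deriv ?_
        rw [← h1 x hm.1]
        ring)
  have h0 := hC 0 left_mem_uIcc
  have h2 := hC t right_mem_uIcc
  rw [← h0] at h2
  simp only [avg, h.init₀, mul_zero, Real.exp_zero, one_mul, id, sub_zero] at h2
  unfold avg
  linarith

/-- The averages of the protocol states vanish asymptotically if there is damping or if they vanish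
initially. -/
theorem IsTrajectory.tendsto_avg (h : IsTrajectory G k₀ k₁ γ L s a b η₀ η₁)
    (hγ : 0 < γ ∨ (∑ i, a i = 0 ∧ ∑ i, b i = 0)) :
    Tendsto (avg η₀) atTop (𝓝 0) ∧ Tendsto (avg η₁) atTop (𝓝 0) := by
  have e0 := (eventually_ge_atTop (0 : ℝ)).mono fun t ht => (h.avg_eq ht).2
  have e1 := (eventually_ge_atTop (0 : ℝ)).mono fun t ht => (h.avg_eq ht).1
  rw [tendsto_congr' e0, tendsto_congr' e1]
  rcases hγ with hγ | ⟨ha, hb⟩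
  · have t1 : Tendsto (fun t => Real.exp (-γ * t)) atTop (𝓝 0) := by
      simpa using tendsto_rpow_mul_exp_neg_mul_atTop_nhds_zero 0 γ hγ
    have t2 : Tendsto (fun t => t * Real.exp (-γ * t)) atTop (𝓝 0) := by
      simpa using tendsto_rpow_mul_exp_neg_mul_atTop_nhds_zero 1 γ hγ
    refine ⟨?_, by simpa using t1.mul_const (1 / (N : ℝ) * ∑ i, b i)⟩
    have := (t1.mul_const (1 / (N : ℝ) * ∑ i, a i)).add (t2.mul_const (1 / (N : ℝ) * ∑ i, b i))
    simp only [zero_mul, add_zero] at this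
    refine this.congr fun t => by ring
  · simp [ha, hb]

theorem sub_avg_eq_of_consensus [NeZero N] (hs : ∀ i, TwiceDifferentiable (s i)) {t : ℝ}
    (ht : 0 ≤ t) (h : ∀ i j, est0 s η₀ i t = est0 s η₀ j t ∧
      est1 γ s η₀ η₁ i t = est1 γ s η₀ η₁ j t) (i : Fin N) :
    est0 s η₀ i t - avg s t = -avg η₀ t ∧
      est1 γ s η₀ η₁ i t - dot (avg s) t = -avg η₁ t + γ * avg η₀ t := by
  have hN : (N : ℝ) ≠ 0 := Nat.cast_ne_zero.2 (NeZero.ne N)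
  have hmean : ∀ v : Fin N → ℝ, (∀ j, v i = v j) → v i = 1 / (N : ℝ) * ∑ j, v j := by
    intro v hv
    simp only [← hv, Finset.sum_const, Finset.card_univ, Fintype.card_fin, nsmul_eq_mul]
    field_simp
  have h0 := hmean (fun j => est0 s η₀ j t) fun j => (h i j).1
  have h1 := hmean (fun j => est1 γ s η₀ η₁ j t) fun j => (h i j).2
  rw [h0, h1, dot_avg (fun i => (hs i).1) ht]
  simp only [avg, est0, est1, Finset.sum_add_distrib, Finset.sum_sub_distrib, ← Finset.mul_sum]
  constructor <;> ring

end Trajectory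

end Redcho

theorem theorem1 {N : ℕ} (G : SimpleGraph (Fin N)) [DecidableRel G.Adj] (hG : G.Connected) :
    ∃ k₀ k₁ : ℝ, 0 < k₀ ∧ 0 < k₁ ∧
      ∀ (γ L : ℝ), 0 ≤ γ → 0 < L →
      ∀ s : Fin N → ℝ → ℝ, (∀ i, Redcho.TwiceDifferentiable (s i)) →
        Redcho.BoundedMismatch s γ L →
      ∀ a b : Fin N → ℝ,
        -- finite-time consensus
        (∃ T : ℝ, 0 ≤ T ∧
          ∀ η₀ η₁ : Fin N → ℝ → ℝ, Redcho.IsTrajectory G k₀ k₁ γ L s a b η₀ η₁ →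
            ∀ i j : Fin N, ∀ t : ℝ, T ≤ t →
              Redcho.est0 s η₀ i t = Redcho.est0 s η₀ j t ∧
              Redcho.est1 γ s η₀ η₁ i t = Redcho.est1 γ s η₀ η₁ j t) ∧
        -- asymptotic recovery of the average signal and of its derivative
        ((0 < γ ∨ (∑ i, a i = 0 ∧ ∑ i, b i = 0)) →
          ∀ η₀ η₁ : Fin N → ℝ → ℝ, Redcho.IsTrajectory G k₀ k₁ γ L s a b η₀ η₁ →
            ∀ i : Fin N,
              Tendsto (fun t => |Redcho.est0 s η₀ i t - Redcho.avg s t|) atTop (𝓝 0) ∧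
              Tendsto (fun t => |Redcho.est1 γ s η₀ η₁ i t - Redcho.dot (Redcho.avg s) t|)
                atTop (𝓝 0)) := by
  have hN : NeZero N := ⟨fun h => by subst h; exact hG.nonempty.elim fun i => i.elim0⟩
  have hC : 0 ≤ Redcho.sqrtGainBound N := by unfold Redcho.sqrtGainBound; positivity
  refine ⟨√(Redcho.sqrtGainBound N + 1), Redcho.signGain N, by positivity,
    by unfold Redcho.signGain; positivity, ?_⟩
  intro γ L hγ hL s hs hb a b
  obtain ⟨T, hT, hcons⟩ := Redcho.exists_consensus_time hG hγ hL (by positivity)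
    (Real.sq_sqrt (by positivity)).ge hs hb a b
  refine ⟨⟨T, hT, hcons⟩, fun hab η₀ η₁ h i => ?_⟩
  obtain ⟨h0, h1⟩ := h.tendsto_avg hab
  have he := (eventually_ge_atTop T).mono fun t ht =>
    Redcho.sub_avg_eq_of_consensus hs (hT.trans ht) (fun i j => hcons η₀ η₁ h i j t ht) i
  have l0 : Tendsto (fun t => |-Redcho.avg η₀ t|) atTop (𝓝 0) := by simpa using h0.neg.abs
  have l1 : Tendsto (fun t => |-Redcho.avg η₁ t + γ * Redcho.avg η₀ t|) atTop (𝓝 0) := by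
    simpa using (h1.neg.add (h0.const_mul γ)).abs
  exact ⟨l0.congr' (he.mono fun t ht => congrArg abs ht.1.symm),
    l1.congr' (he.mono fun t ht => congrArg abs ht.2.symm)⟩
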